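/- Let $\omega=e^{2\pi i/3}$, $\mathcal{E}=\mathbb{Z}[\omega]$ and $\theta=\omega-\bar\omega=\sqrt{-3}$, and identify $\mathcal{E}/\theta\mathcal{E}$ with $\mathbb{F}_3$. Equip $\mathbb{C}^{14}$ with the Hermitian form $\langle x,y\rangle=-x_0\bar y_0+x_1\bar y_1+\dots+x_{13}\bar y_{13}$, the last 13 coordinates being indexed by the points of the projective plane $P^2\mathbb{F}_3$. Let $\mathcal{C}\subseteq\mathbb{F}_3^{13}$ be the span of the differences of characteristic functions of lines of $P^2\mathbb{F}_3$, and let $\mathcal{C}^\perp$ be its orthogonal complement for the usual inner product. Let $L=L_{13,1}$ be the $\mathcal{E}$-lattice of all $(x_0;x_1,\dots,x_{13})\in\mathcal{E}^{14}$ such that $x_0\equiv x_1+\dots+x_{13}\pmod\theta$ and the reduction of $(x_1,\dots,x_{13})$ modulo $\theta$ lies in $\mathcal{C}^\perp$. The 13 point roots are the vectors $(0;\theta,0^{12})$, with $\theta$ in any of the last 13 coordinates; the 13 line roots are the vectors $(1;1^4,0^9)$, with the $1$'s along a line of $P^2\mathbb{F}_3$. For $r$ with $\langle r,r\rangle\neq0$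 and $\zeta$ a root of unity, the $\zeta$-reflection in $r$ is $x\mapsto x+(\zeta-1)\frac{\langle x,r\rangle}{\langle r,r\rangle}r$; the triflections in $r$ are the $\zeta$-reflections with $\zeta$ of order 3. Let $\Delta$ be the incidence graph of the points and lines of $P^2\mathbb{F}_3$, and let $Y_{555}$ be the tree with 16 nodes consisting of a central node and three arms of five nodes each. The graph $Y_{555}$ embeds in $\Delta$ as an induced subgraph. For every such embedding, let $R$ be the group generated by the $\omega$-reflections in the 16 point and line roots that correspond to the nodes of $Y_{555}$. Then these 16 roots span $L$ over $\mathcal{E}$; the group $R$ contains the triflections in all 26 point and line roots; and $R$ contains the group $L_3(3)=\mathrm{PSL}_3(\mathbb{F}_3)$, acting on $\mathbb{C}^{14}$ by permuting the last 13 coordinates as it permutes the points of $P^2\mathbb{F}_3$. -/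

import Mathlib

noncomputable section

namespace Y555

open scoped LinearAlgebra.Projectivization MatrixGroups

/-- The primitive cube root of unity `ω = (-1 + √-3) / 2`. -/
def ω : ℂ := (-1 + (Real.sqrt 3 : ℂ) * Complex.I) / 2

theorem ω_sq : ω ^ 2 = -1 - ω := by
  have h : (Real.sqrt 3 : ℂ) ^ 2 = 3 := by
    rw [← Complex.ofReal_pow, Real.sq_sqrt (by norm_num)]; norm_num
  unfold ω
  linear_combination (1 / 4) * (Complex.I ^ 2) * h + (3 / 4) * Complex.I_sq

theorem ω_ne_zero : ω ≠ 0 := by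
  intro h
  have := ω_sq
  rw [h] at this
  norm_num at this

/-- `ω` as a unit of `ℂ`. -/
def ωUnit : ℂˣ := Units.mk0 ω ω_ne_zero

/-- `θ = ω - conj ω = √-3`. -/
def θ : ℂ := ω - (starRingEnd ℂ) ω

theorem θ_eq : θ = 1 + 2 * ω := by
  unfold θ ω
  simp only [map_div₀, map_add, map_neg, map_one, map_mul, Complex.conj_ofReal, Complex.conj_I,
    map_ofNat]
  ring

/-- The Eisenstein integers `ℤ[ω] = {a + b ω | a b : ℤ}`, as a subring of `ℂ`. -/
def Eis : Subring ℂ where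
  carrier := {z | ∃ a b : ℤ, z = a + b * ω}
  zero_mem' := ⟨0, 0, by simp⟩
  one_mem' := ⟨1, 0, by simp⟩
  add_mem' := by
    rintro _ _ ⟨a, b, rfl⟩ ⟨c, d, rfl⟩
    exact ⟨a + c, b + d, by push_cast; ring⟩
  neg_mem' := by
    rintro _ ⟨a, b, rfl⟩
    exact ⟨-a, -b, by push_cast; ring⟩
  mul_mem' := by
    rintro _ _ ⟨a, b, rfl⟩ ⟨c, d, rfl⟩
    refine ⟨a * c - b * d, a * d + b * c - b * d, ?_⟩
    push_cast
    linear_combination (b * d : ℂ) * ω_sq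

theorem θ_mem : θ ∈ Eis := ⟨1, 2, by rw [θ_eq]; push_cast; ring⟩

/-- Congruence modulo `θ` in `ℤ[ω]`: `x ≡ y` when `x - y ∈ θ ℤ[ω]`. -/
def CongrTheta (x y : ℂ) : Prop := ∃ e ∈ Eis, x - y = θ * e

theorem CongrTheta.add {x y x' y' : ℂ} (h : CongrTheta x y) (h' : CongrTheta x' y') :
    CongrTheta (x + x') (y + y') := by
  obtain ⟨e, he, h⟩ := h
  obtain ⟨e', he', h'⟩ := h'
  exact ⟨e + e', Eis.add_mem he he', by linear_combination h + h'⟩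

theorem CongrTheta.mul_left {x y c : ℂ} (hc : c ∈ Eis) (h : CongrTheta x y) :
    CongrTheta (c * x) (c * y) := by
  obtain ⟨e, he, h⟩ := h
  exact ⟨c * e, Eis.mul_mem hc he, by linear_combination c * h⟩

theorem CongrTheta.trans {x y z : ℂ} (h : CongrTheta x y) (h' : CongrTheta y z) :
    CongrTheta x z := by
  obtain ⟨e, he, h⟩ := h
  obtain ⟨e', he', h'⟩ := h'
  exact ⟨e + e', Eis.add_mem he he', by linear_combination h + h'⟩

/-- Integers that agree modulo `3` are congruent modulo `θ`. -/
theorem congrTheta_intCast {m n : ℤ} (h : (m : ZMod 3) = n) : CongrTheta m n := by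
  obtain ⟨k, hk⟩ := (ZMod.intCast_eq_intCast_iff_dvd_sub n m 3).1 h.symm
  have hk' : (m : ℂ) - n = 3 * k := by exact_mod_cast hk
  refine ⟨-θ * k, Eis.mul_mem (Eis.neg_mem θ_mem) (intCast_mem Eis k), ?_⟩
  rw [θ_eq]
  linear_combination hk' + 4 * (k : ℂ) * ω_sq

/-- Every Eisenstein integer `a + b ω` is congruent to the integer `a + b` modulo `θ`. -/
theorem exists_int_congrTheta {c : ℂ} (hc : c ∈ Eis) : ∃ n : ℤ, CongrTheta c n := by
  obtain ⟨a, b, rfl⟩ := hc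
  refine ⟨a + b, b * (1 + ω), ⟨b, b, by ring⟩, ?_⟩
  rw [θ_eq]
  push_cast
  linear_combination (-2 * (b : ℂ)) * ω_sq

/-! ### The projective plane over `𝔽₃` and its codes -/

/-- The points of `P²(𝔽₃)`. -/
abbrev Point : Type := ℙ (ZMod 3) (Fin 3 → ZMod 3)

/-- The lines of `P²(𝔽₃)`, in homogeneous line coordinates: `l` stands for the line
`{p | p ⬝ l = 0}`. -/
abbrev Line : Type := ℙ (ZMod 3) (Fin 3 → ZMod 3)

instance : Fintype Point := Fintype.ofFinite _

/-- The set of points on a line. -/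
def pointsOn (l : Line) : Set Point := {p | Projectivization.orthogonal p l}

/-- The characteristic function of a line, in `𝔽₃¹³`. -/
def lineWord (l : Line) : Point → ZMod 3 := (pointsOn l).indicator 1

/-- The line difference code `𝒞`, spanned by the differences of lines. -/
def lineDiffCode : Submodule (ZMod 3) (Point → ZMod 3) :=
  Submodule.span (ZMod 3) {w | ∃ l m : Line, w = lineWord l - lineWord m}

/-- The line code `𝒞^⊥`, the orthogonal complement of `𝒞` for the usual inner product. -/
def lineCode : Submodule (ZMod 3) (Point → ZMod 3) where
  carrier := {w | ∀ c ∈ lineDiffCode, ∑ p, w p * c p = 0}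
  zero_mem' := by
    intro c _
    simp
  add_mem' := by
    intro v w hv hw c hc
    simp only [Pi.add_apply, add_mul, Finset.sum_add_distrib, hv c hc, hw c hc, add_zero]
  smul_mem' := by
    intro a w hw c hc
    simp only [Pi.smul_apply, smul_eq_mul, mul_assoc, ← Finset.mul_sum, hw c hc, mul_zero]

/-! ### The Hermitian space `ℂ^{13,1}` and the lattice `L` -/

/-- `ℂ¹⁴`, with vectors `(x₀; x₁, …, x₁₃)`, the last 13 coordinates being indexed by the points
of `P²(𝔽₃)`. -/
abbrev V : Type := ℂ × (Point → ℂ)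

/-- The Hermitian form of signature `(13, 1)`, linear in the first argument:
`⟨x, y⟩ = -x₀ conj y₀ + x₁ conj y₁ + ⋯ + x₁₃ conj y₁₃`. -/
def herm (x y : V) : ℂ :=
  -(x.1 * (starRingEnd ℂ) y.1) + ∑ p, x.2 p * (starRingEnd ℂ) (y.2 p)

theorem herm_add_left (x y z : V) : herm (x + y) z = herm x z + herm y z := by
  simp only [herm, Prod.fst_add, Prod.snd_add, Pi.add_apply, add_mul, Finset.sum_add_distrib]
  ring

theorem herm_smul_left (a : ℂ) (x z : V) : herm (a • x) z = a * herm x z := by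
  simp only [herm, Prod.smul_fst, Prod.smul_snd, Pi.smul_apply, smul_eq_mul, mul_assoc,
    ← Finset.mul_sum]
  ring

/-- The lattice `L = L_{13,1}`: the vectors `(x₀; x₁, …, x₁₃)` over `ℤ[ω]` such that
`x₀ ≡ x₁ + ⋯ + x₁₃` modulo `θ` and the reduction of `(x₁, …, x₁₃)` modulo `θ` lies in `𝒞^⊥`.
Here `ℤ[ω]/θ` is identified with `𝔽₃`, so the reduction of `(x₁, …, x₁₃)` is the word `c` over
`𝔽₃` whose integer representatives are congruent to the `xᵢ` modulo `θ`. -/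
def L : Submodule Eis V where
  carrier := {x | x.1 ∈ Eis ∧ (∀ p, x.2 p ∈ Eis) ∧ CongrTheta x.1 (∑ p, x.2 p) ∧
    ∃ c ∈ lineCode, ∀ p, CongrTheta (x.2 p) ((c p).val : ℂ)}
  zero_mem' := by
    refine ⟨Eis.zero_mem, fun _ => Eis.zero_mem, ⟨0, Eis.zero_mem, by simp⟩, 0,
      lineCode.zero_mem, fun _ => ⟨0, Eis.zero_mem, by simp⟩⟩
  add_mem' := by
    rintro x y ⟨h1, h2, h3, c, hc, h4⟩ ⟨k1, k2, k3, d, hd, k4⟩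
    refine ⟨Eis.add_mem h1 k1, fun p => Eis.add_mem (h2 p) (k2 p), ?_, c + d,
      lineCode.add_mem hc hd, fun p => ?_⟩
    · simpa only [Prod.fst_add, Prod.snd_add, Pi.add_apply, Finset.sum_add_distrib]
        using h3.add k3
    · refine ((h4 p).add (k4 p)).trans ?_
      have := congrTheta_intCast (m := ((c p).val + (d p).val : ℕ))
        (n := (((c + d) p).val : ℕ)) (by simp)
      exact_mod_cast this
  smul_mem' := by
    rintro ⟨e, he⟩ x ⟨h1, h2, h3, c, hc, h4⟩
    obtain ⟨n, hn⟩ := exists_int_congrTheta he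
    refine ⟨Eis.mul_mem he h1, fun p => Eis.mul_mem he (h2 p), ?_, (n : ZMod 3) • c,
      lineCode.smul_mem _ hc, fun p => ?_⟩
    · have := h3.mul_left he
      rw [Finset.mul_sum] at this
      exact this
    · have hv : (((c p).val : ℕ) : ℂ) ∈ Eis := natCast_mem Eis _
      have h5 := hn.mul_left hv
      rw [mul_comm, mul_comm _ (n : ℂ)] at h5
      refine ((h4 p).mul_left he).trans (h5.trans ?_)
      have := congrTheta_intCast (m := n * ((c p).val : ℕ))
        (n := ((((n : ZMod 3) • c) p).val : ℕ)) (by simp)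
      exact_mod_cast this

/-! ### Point roots, line roots and their reflections -/

open Classical in
/-- The point root `(0; θ, 0¹²)` with `θ` in the position of `p`. -/
def pointRoot (p : Point) : V := (0, Pi.single p θ)

/-- The line root `(1; 1⁴, 0⁹)` with the `1`s along the line `l`. -/
def lineRoot (l : Line) : V := (1, (pointsOn l).indicator 1)

/-- The 26 point and line roots, indexed by the points and lines of `P²(𝔽₃)`. -/
def root : Point ⊕ Line → V := Sum.elim pointRoot lineRoot

/-- The linear map `x ↦ x + (ζ - 1) (⟨x, r⟩ / ⟨r, r⟩) r`: for `⟨r, r⟩ ≠ 0` it multiplies `r` by `ζ`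
and fixes the orthogonal complement of `r` pointwise. -/
def reflectionMap (ζ : ℂ) (r : V) : V →ₗ[ℂ] V where
  toFun x := x + ((ζ - 1) * (herm x r / herm r r)) • r
  map_add' x y := by
    rw [herm_add_left]
    module
  map_smul' a x := by
    rw [herm_smul_left, RingHom.id_apply]
    module

theorem reflectionMap_comp (ζ ξ : ℂ) (h : ζ * ξ = 1) (r x : V) :
    reflectionMap ζ r (reflectionMap ξ r x) = x := by
  simp only [reflectionMap, LinearMap.coe_mk, AddHom.coe_mk, herm_add_left, herm_smul_left]
  by_cases hr : herm r r = 0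
  · simp [hr]
  · have : (herm x r + (ξ - 1) * (herm x r / herm r r) * herm r r) / herm r r
        = ξ * (herm x r / herm r r) := by
      field_simp
      ring
    rw [this, add_assoc, ← add_smul]
    have h0 : (ξ - 1) * (herm x r / herm r r) + (ζ - 1) * (ξ * (herm x r / herm r r)) = 0 := by
      linear_combination (herm x r / herm r r) * h
    rw [h0, zero_smul, add_zero]

/-- The `ζ`-reflection in `r`, as an element of `GL(V)`. For a root `r` and `ζ` of order 3 this is a
triflection in `r`. -/
def reflection (ζ : ℂˣ) (r : V) : V ≃ₗ[ℂ] V where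
  __ := reflectionMap ζ r
  invFun := reflectionMap (ζ⁻¹ : ℂˣ) r
  left_inv x := reflectionMap_comp _ _ (by simp) r x
  right_inv x := reflectionMap_comp _ _ (by simp) r x

/-! ### The action of `L₃(3)` -/

/-- The action of `L₃(3) = PSL(3, 𝔽₃)` on `V` that permutes the last 13 coordinates as it permutes
the points of `P²(𝔽₃)`. -/
def permAction : PSL(3, ZMod 3) →* (V ≃ₗ[ℂ] V) where
  toFun g :=
    { toFun := fun x => (x.1, fun p => x.2 (g⁻¹ • p))
      invFun := fun x => (x.1, fun p => x.2 (g • p))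
      map_add' := fun _ _ => rfl
      map_smul' := fun _ _ => rfl
      left_inv := fun x => by simp
      right_inv := fun x => by simp }
  map_one' := by
    ext x <;> simp
  map_mul' g h := by
    ext x <;> simp [mul_smul]

/-- The copy of `L₃(3)` in `GL(V)` that permutes the coordinates. -/
def L33 : Subgroup (V ≃ₗ[ℂ] V) := permAction.range

/-! ### The incidence graph and the `Y₅₅₅` diagram -/

/-- The incidence graph `Δ` of the points and lines of `P²(𝔽₃)`. -/
def incidenceGraph : SimpleGraph (Point ⊕ Line) where
  Adj u v := (∃ p l, p ∈ pointsOn l ∧ u = Sum.inl p ∧ v = Sum.inr l) ∨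
    (∃ p l, p ∈ pointsOn l ∧ v = Sum.inl p ∧ u = Sum.inr l)
  symm := ⟨fun _ _ h => h.symm⟩
  loopless := ⟨by
    rintro u (⟨p, l, _, h, h'⟩ | ⟨p, l, _, h, h'⟩) <;>
    · rw [h] at h'
      cases h'⟩

/-- The `Y₅₅₅` diagram: a central node `none` and three arms of five nodes each, `some (a, i)` being
the node at distance `i + 1` from the center on the arm `a`. -/
def diagram : SimpleGraph (Option (Fin 3 × Fin 5)) :=
  SimpleGraph.fromRel fun u v =>
    (∃ a, u = none ∧ v = some (a, 0)) ∨
    (∃ a : Fin 3, ∃ i j : Fin 5, j.val = i.val + 1 ∧ u = some (a, i) ∧ v = some (a, j))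

/-- The group `R` generated by the `ω`-reflections in the 16 roots of a `Y₅₅₅` diagram in `Δ`. -/
def R (f : diagram ↪g incidenceGraph) : Subgroup (V ≃ₗ[ℂ] V) :=
  Subgroup.closure (Set.range fun i => reflection ωUnit (root (f i)))

end Y555

end

noncomputable section

namespace Y555

open scoped LinearAlgebra.Projectivization MatrixGroups ComplexConjugate
open Matrix Matrix.SpecialLinearGroup

/-! ### Cyclic coordinates on the projective plane -/

/-! All roots have norm 3, and two of them have inner product `±θ` if they are incident and 0
otherwise. In an induced 12-gon of the incidence graph, signs can be chosen so that consecutive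
inner products are `θ`. Then the sum of the `(ω ^ 2) ^ i` times the signed roots is orthogonal to
each of these roots, so it has norm 0. Its first coordinate is also 0, and the form is positive
definite on that hyperplane, so the sum vanishes (`sum_gonRoot`). Each root of a 12-gon is therefore
an Eisenstein combination of the other eleven. Moreover, carrying a partial sum along a chain by
successive reflections puts the reflection in the last root into the group generated by the other
eleven (`reflection_sum_mem`). Hence the nodes whose root lies in the span of the 16 and whose
reflection lies in `R` are closed under completing 12-gons (`gonClosed_root_mem`).

The rest of this part is combinatorial. Up to polarity and collineations there is only one `Y₅₅₅`
subdiagram (`exists_collineation`), and from it twelve-gons reach all 26 nodes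
(`GonClosed.eq_univ_of_standard`). That gives all triflections. It also gives the span, since the 26
roots generate `L`: the line code is spanned by lines (`exists_eq_sum_lineWord`), so line roots
reduce a vector of `L` to one divisible by `θ`.

For `L₃(3)`, the Garside elements of two suitable chains of five roots differ by a coordinate
permutation, a homology of the plane (`cyclicGarside_eq_mul`). Permutations of coordinates permute
the 26 roots and so normalize `R`. The part of `L₃(3)` inside `R` is thus normal and contains a
homology, whose normal closure is everything (`eq_top_of_homology_mem`). -/

/-- The incidence relation of the cyclic model of `P²(𝔽₃)`: the point `i` lies on the line `j` when
`i + j` belongs to the perfect difference set `{0, 1, 3, 9}` modulo `13`. -/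
def cyclicInc (i j : Fin 13) : Bool := i + j = 0 ∨ i + j = 1 ∨ i + j = 3 ∨ i + j = 9

/-- Homogeneous coordinates for the points (and the lines) of the cyclic model. -/
def cyclicVec : Fin 13 → Fin 3 → ZMod 3 :=
  ![![1, 1, 1], ![2, 0, 1], ![1, 0, 1], ![1, 2, 0], ![2, 0, 0], ![0, 2, 2], ![1, 1, 0],
    ![1, 2, 2], ![1, 2, 1], ![0, 1, 2], ![0, 0, 2], ![2, 2, 1], ![0, 2, 0]]

theorem cyclicVec_ne_zero (i : Fin 13) : cyclicVec i ≠ 0 := by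
  revert i; decide +kernel

theorem cyclicVec_dotProduct (i j : Fin 13) :
    cyclicVec i ⬝ᵥ cyclicVec j = 0 ↔ cyclicInc i j := by
  revert i j; decide +kernel

theorem cyclicVec_injective {i j : Fin 13} {a : ZMod 3} :
    a • cyclicVec j = cyclicVec i → i = j := by
  revert i j a; decide +kernel

theorem cyclicVec_surjective (v : Fin 3 → ZMod 3) (hv : v ≠ 0) :
    ∃ i, ∃ a : ZMod 3, a • v = cyclicVec i := by
  revert v; decide +kernel

/-- The point with label `i` in the cyclic model. -/
def cyclicPoint (i : Fin 13) : Point := .mk (ZMod 3) (cyclicVec i) (cyclicVec_ne_zero i)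

theorem cyclicPoint_bijective : Function.Bijective cyclicPoint := by
  constructor
  · intro i j h
    obtain ⟨a, ha⟩ := (Projectivization.mk_eq_mk_iff' _ _ _ _ _).1 h
    exact cyclicVec_injective ha
  · intro p
    induction p using Projectivization.ind with | _ v hv =>
    obtain ⟨i, a, ha⟩ := cyclicVec_surjective v hv
    exact ⟨i, (Projectivization.mk_eq_mk_iff' _ _ _ _ _).2 ⟨a, ha⟩⟩

/-- The labelling of the points by `Fin 13`. -/
def cyclicEquiv : Fin 13 ≃ Point := Equiv.ofBijective _ cyclicPoint_bijective

theorem cyclicEquiv_apply (i : Fin 13) :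
    cyclicEquiv i = .mk (ZMod 3) (cyclicVec i) (cyclicVec_ne_zero i) := rfl

theorem mem_pointsOn_mk {v w : Fin 3 → ZMod 3} (hv : v ≠ 0) (hw : w ≠ 0) :
    (.mk (ZMod 3) v hv : Point) ∈ pointsOn (.mk (ZMod 3) w hw) ↔ v ⬝ᵥ w = 0 :=
  Projectivization.orthogonal_mk hv hw

theorem mem_pointsOn_comm {p l : Point} : p ∈ pointsOn l ↔ l ∈ pointsOn p :=
  Projectivization.orthogonal_comm

theorem cyclicEquiv_mem_pointsOn (i j : Fin 13) :
    cyclicEquiv i ∈ pointsOn (cyclicEquiv j) ↔ cyclicInc i j := by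
  rw [cyclicEquiv_apply, cyclicEquiv_apply, mem_pointsOn_mk, cyclicVec_dotProduct]

/-! ### Symmetries of the incidence graph -/

@[simp]
theorem incidenceGraph_adj_inl_inr {p : Point} {l : Line} :
    incidenceGraph.Adj (.inl p) (.inr l) ↔ p ∈ pointsOn l := by
  simp [incidenceGraph]

@[simp]
theorem incidenceGraph_adj_inr_inl {p : Point} {l : Line} :
    incidenceGraph.Adj (.inr l) (.inl p) ↔ p ∈ pointsOn l := by
  simp [incidenceGraph]

@[simp]
theorem incidenceGraph_not_adj_inl_inl {p q : Point} :
    ¬ incidenceGraph.Adj (.inl p) (.inl q) := by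
  simp [incidenceGraph]

@[simp]
theorem incidenceGraph_not_adj_inr_inr {l m : Line} :
    ¬ incidenceGraph.Adj (.inr l) (.inr m) := by
  simp [incidenceGraph]

/-- The graph of the cyclic model. -/
def cyclicGraph : SimpleGraph (Fin 13 ⊕ Fin 13) where
  Adj
    | .inl i, .inr j => cyclicInc i j
    | .inr j, .inl i => cyclicInc i j
    | _, _ => False
  symm := ⟨by rintro (i | i) (j | j) h <;> exact h⟩
  loopless := ⟨by rintro (i | i) h <;> exact h⟩

instance : DecidableRel cyclicGraph.Adj
  | .inl i, .inr j => inferInstanceAs (Decidable (cyclicInc i j = true))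
  | .inr j, .inl i => inferInstanceAs (Decidable (cyclicInc i j = true))
  | .inl _, .inl _ => inferInstanceAs (Decidable False)
  | .inr _, .inr _ => inferInstanceAs (Decidable False)

/-- The graph of the cyclic model is the incidence graph. -/
def cyclicIso : cyclicGraph ≃g incidenceGraph where
  toEquiv := Equiv.sumCongr cyclicEquiv cyclicEquiv
  map_rel_iff' := by
    rintro (i | i) (j | j) <;> simp [cyclicGraph, cyclicEquiv_mem_pointsOn]

/-- The polarity that exchanges points and lines with the same homogeneous coordinates. -/
def polarity : incidenceGraph ≃g incidenceGraph where
  toEquiv := Equiv.sumComm _ _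
  map_rel_iff' := by
    rintro (i | i) (j | j) <;> simp [mem_pointsOn_comm]

/-- The inverse transpose of an invertible matrix. -/
def contragredient (g : GL (Fin 3) (ZMod 3)) : GL (Fin 3) (ZMod 3) where
  val := (g⁻¹).1ᵀ
  inv := g.1ᵀ
  val_inv := by rw [← transpose_mul, ← Units.val_mul]; simp
  inv_val := by rw [← transpose_mul, ← Units.val_mul]; simp

/-- Lines are given by linear forms, so they move by the inverse transpose: this preserves `v ⬝ᵥ w`.
-/
theorem smul_mem_pointsOn_smul (g : GL (Fin 3) (ZMod 3)) (p l : Point) :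
    g • p ∈ pointsOn (contragredient g • l) ↔ p ∈ pointsOn l := by
  induction p using Projectivization.ind with | _ v hv =>
  induction l using Projectivization.ind with | _ w hw =>
  rw [Projectivization.smul_mk, Projectivization.smul_mk, mem_pointsOn_mk, mem_pointsOn_mk]
  have : (g • v) ⬝ᵥ (contragredient g • w) = v ⬝ᵥ w := by
    change (g.1 *ᵥ v) ⬝ᵥ ((g⁻¹).1ᵀ *ᵥ w) = v ⬝ᵥ w
    rw [dotProduct_mulVec, vecMul_transpose, mulVec_mulVec, ← Units.val_mul]
    simp
  rw [this]

/-- The collineation defined by an invertible matrix. -/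
def collineation (g : GL (Fin 3) (ZMod 3)) : incidenceGraph ≃g incidenceGraph where
  toEquiv := Equiv.sumCongr (MulAction.toPerm g) (MulAction.toPerm (contragredient g))
  map_rel_iff' := by
    rintro (i | i) (j | j) <;> simp [smul_mem_pointsOn_smul]

/-! ### Moving a `Y₅₅₅` diagram to a standard position -/

/-- `GL₃(𝔽₃)` is transitive on the triples consisting of a point `p` and points `q₀`, `q₁` that are
not collinear with `p`, and the stabilizer of such a triple has two orbits on the remaining points
off the lines `p q₀` and `p q₁`. -/
theorem exists_smul_eq_of_lines {p q₀ q₁ q₂ : Point} {l₀ l₁ : Line}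
    (hp₀ : p ∈ pointsOn l₀) (hp₁ : p ∈ pointsOn l₁) (h₀₀ : q₀ ∈ pointsOn l₀)
    (h₁₁ : q₁ ∈ pointsOn l₁) (h₀₁ : q₀ ∉ pointsOn l₁) (h₁₀ : q₁ ∉ pointsOn l₀)
    (h₂₀ : q₂ ∉ pointsOn l₀) (h₂₁ : q₂ ∉ pointsOn l₁) :
    ∃ g : GL (Fin 3) (ZMod 3), g • cyclicEquiv 10 = p ∧ g • cyclicEquiv 4 = q₀ ∧
      g • cyclicEquiv 12 = q₁ ∧ (g • cyclicEquiv 0 = q₂ ∨ g • cyclicEquiv 6 = q₂) := by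
  induction p using Projectivization.ind with | _ v hv =>
  induction q₀ using Projectivization.ind with | _ v₀ hv₀ =>
  induction q₁ using Projectivization.ind with | _ v₁ hv₁ =>
  induction q₂ using Projectivization.ind with | _ v₂ hv₂ =>
  induction l₀ using Projectivization.ind with | _ u₀ hu₀ =>
  induction l₁ using Projectivization.ind with | _ u₁ hu₁ =>
  rw [mem_pointsOn_mk] at *
  have expand (c u : Fin 3 → ZMod 3) : (of ![v₀, v₁, v])ᵀ *ᵥ c ⬝ᵥ u =
      c 0 * (v₀ ⬝ᵥ u) + c 1 * (v₁ ⬝ᵥ u) + c 2 * (v ⬝ᵥ u) := by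
    simp only [mulVec, dotProduct, Fin.sum_univ_three, transpose_apply, of_apply, cons_val]
    ring
  -- The three points form a basis: in a linear relation, pairing with `u₀` leaves only the
  -- coefficient of `v₁`, and pairing with `u₁` only that of `v₀`.
  have hdet : (of ![v₀, v₁, v])ᵀ.det ≠ 0 := by
    intro h
    obtain ⟨c, hc, h⟩ := exists_mulVec_eq_zero_iff.2 h
    have e₀ := expand c u₀
    have e₁ := expand c u₁
    rw [h, zero_dotProduct] at e₀ e₁
    have c1 : c 1 = 0 := by simpa [hp₀, h₀₀, h₁₀] using e₀.symm
    have c0 : c 0 = 0 := by simpa [hp₁, h₁₁, h₀₁] using e₁.symm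
    obtain ⟨i, hi⟩ := Function.ne_iff.1 hv
    have c2 : c 2 = 0 := by
      have := congrFun h i
      simp only [mulVec, dotProduct, Fin.sum_univ_three, transpose_apply, of_apply, cons_val, c0,
        c1, mul_zero, zero_add, Pi.zero_apply, mul_eq_zero] at this
      exact this.resolve_left hi
    apply hc
    ext i
    fin_cases i <;> assumption
  obtain ⟨c, hc⟩ : ∃ c, (of ![v₀, v₁, v])ᵀ *ᵥ c = v₂ :=
    ⟨(of ![v₀, v₁, v])ᵀ⁻¹ *ᵥ v₂, by
      rw [mulVec_mulVec, mul_nonsing_inv _ (isUnit_iff_ne_zero.2 hdet), one_mulVec]⟩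
  have c0 : c 0 ≠ 0 := by
    intro h
    apply h₂₁
    rw [← hc, expand, h, h₁₁, hp₁]
    ring
  have c1 : c 1 ≠ 0 := by
    intro h
    apply h₂₀
    rw [← hc, expand, h, h₀₀, hp₀]
    ring
  -- Rescaling the basis makes the first two coordinates of `q₂` equal to 1. The third becomes 1 or
  -- is 0; this is the source of the two orbits. In the second case the scale `d` is arbitrary.
  obtain ⟨d, hd, hcd⟩ : ∃ d : ZMod 3, d ≠ 0 ∧ (c 2 = d ∨ c 2 = 0) := by
    by_cases h : c 2 = 0
    · exact ⟨1, one_ne_zero, .inr h⟩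
    · exact ⟨c 2, h, .inl rfl⟩
  have hdet' : ((of ![v₀, v₁, v])ᵀ * diagonal ![c 0, c 1, d]).det ≠ 0 := by
    rw [det_mul, det_diagonal]
    exact mul_ne_zero hdet (by simp [Fin.prod_univ_three, c0, c1, hd])
  have key (w x : Fin 3 → ZMod 3) (hw : w ≠ 0) (hx : x ≠ 0) (a : ZMod 3)
      (h : a • x = (of ![v₀, v₁, v])ᵀ *ᵥ (diagonal ![c 0, c 1, d] *ᵥ w)) :
      GeneralLinearGroup.mkOfDetNeZero _ hdet' • (.mk (ZMod 3) w hw : Point) = .mk _ x hx := by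
    rw [Projectivization.smul_mk, Projectivization.mk_eq_mk_iff']
    exact ⟨a, h.trans (mulVec_mulVec _ _ _)⟩
  -- Labels 10, 4, 12 are represented by twice the third, first and second basis vectors, whence the
  -- factors 2; labels 0 and 6 are `(1, 1, 1)` and `(1, 1, 0)`.
  refine ⟨GeneralLinearGroup.mkOfDetNeZero _ hdet', key _ _ _ _ (2 * d) ?_,
    key _ _ _ _ (2 * c 0) ?_, key _ _ _ _ (2 * c 1) ?_, ?_⟩
  · ext i
    simp [mulVec, dotProduct, Fin.sum_univ_three, cyclicVec, diagonal_apply]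
    ring
  · ext i
    simp [mulVec, dotProduct, Fin.sum_univ_three, cyclicVec, diagonal_apply]
    ring
  · ext i
    simp [mulVec, dotProduct, Fin.sum_univ_three, cyclicVec, diagonal_apply]
    ring
  · rcases hcd with h | h
    · refine .inl (key _ _ _ _ 1 ?_)
      rw [one_smul, ← hc, ← h]
      ext i
      simp [mulVec, dotProduct, Fin.sum_univ_three, cyclicVec, diagonal_apply]
    · refine .inr (key _ _ _ _ 1 ?_)
      rw [one_smul, ← hc]
      ext i
      simp [mulVec, dotProduct, Fin.sum_univ_three, cyclicVec, diagonal_apply, h]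

theorem diagram_adj_none_some {a : Fin 3} {i : Fin 5} :
    diagram.Adj none (some (a, i)) ↔ i = 0 := by
  simp [diagram]

theorem diagram_adj_some_some {a b : Fin 3} {i j : Fin 5} :
    diagram.Adj (some (a, i)) (some (b, j)) ↔
      a = b ∧ (j.val = i.val + 1 ∨ i.val = j.val + 1) := by
  simp only [diagram, SimpleGraph.fromRel_adj]
  grind

/-- The nodes of a `Y₅₅₅` diagram in a bipartite incidence structure, with a point at the center: the
lines `l a` through the central point, the points `q a` on them, and the lines `m a`, points `s a`
and lines `n a` further along the arms. -/
structure PointCentered {P : Type*} (inc : P → P → Prop) where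
  p : P
  l : Fin 3 → P
  q : Fin 3 → P
  m : Fin 3 → P
  s : Fin 3 → P
  n : Fin 3 → P
  p_l : ∀ a, inc p (l a)
  p_m : ∀ a, ¬ inc p (m a)
  p_n : ∀ a, ¬ inc p (n a)
  q_l : ∀ a b, inc (q a) (l b) ↔ a = b
  q_m : ∀ a b, inc (q a) (m b) ↔ a = b
  q_n : ∀ a b, ¬ inc (q a) (n b)
  s_l : ∀ a b, ¬ inc (s a) (l b)
  s_m : ∀ a b, inc (s a) (m b) ↔ a = b
  s_n : ∀ a b, inc (s a) (n b) ↔ a = b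
  q_ne_s : ∀ a, q a ≠ s a
  m_ne_n : ∀ a, m a ≠ n a

/-- A diagram in the incidence graph with a point at its center. -/
theorem exists_pointCentered (f : diagram ↪g incidenceGraph) {p : Point} (hp : f none = .inl p) :
    ∃ y : PointCentered fun (p l : Point) => p ∈ pointsOn l, y.p = p ∧
      (∀ a, f (some (a, 0)) = .inr (y.l a)) ∧ (∀ a, f (some (a, 1)) = .inl (y.q a)) ∧
      (∀ a, f (some (a, 2)) = .inr (y.m a)) ∧ (∀ a, f (some (a, 3)) = .inl (y.s a)) ∧
      ∀ a, f (some (a, 4)) = .inr (y.n a) := by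
  have toLine {u v} {p : Point} (hu : f u = .inl p) (h : diagram.Adj u v) :
      ∃ l, f v = .inr l := by
    have := f.map_rel_iff.2 h
    rw [hu] at this
    rcases hv : f v with x | x
    · simp [hv] at this
    · exact ⟨x, rfl⟩
  have toPoint {u v} {l : Line} (hu : f u = .inr l) (h : diagram.Adj u v) :
      ∃ p, f v = .inl p := by
    have := f.map_rel_iff.2 h
    rw [hu] at this
    rcases hv : f v with x | x
    · exact ⟨x, rfl⟩
    · simp [hv] at this
  choose l hl using fun a => toLine hp (diagram_adj_none_some (a := a).2 rfl)
  choose q hq using fun a => toPoint (hl a)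
    (diagram_adj_some_some (b := a) (j := 1).2 ⟨rfl, .inl rfl⟩)
  choose m hm using fun a => toLine (hq a)
    (diagram_adj_some_some (b := a) (j := 2).2 ⟨rfl, .inl rfl⟩)
  choose s hs using fun a => toPoint (hm a)
    (diagram_adj_some_some (b := a) (j := 3).2 ⟨rfl, .inl rfl⟩)
  choose n hn using fun a => toLine (hs a)
    (diagram_adj_some_some (b := a) (j := 4).2 ⟨rfl, .inl rfl⟩)
  -- The embedding is induced, so incidences and non-incidences are both read off from the diagram.
  have hinc {u v} {p : Point} {l : Line} (hu : f u = .inl p) (hv : f v = .inr l) :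
      p ∈ pointsOn l ↔ diagram.Adj u v := by
    rw [← f.map_rel_iff, hu, hv, incidenceGraph_adj_inl_inr]
  refine ⟨⟨p, l, q, m, s, n, ?_, ?_, ?_, ?_, ?_, ?_, ?_, ?_, ?_, ?_, ?_⟩, rfl, hl, hq, hm, hs, hn⟩
  · simp [hinc hp (hl _), diagram_adj_none_some]
  · simp [hinc hp (hm _), diagram_adj_none_some]
  · simp [hinc hp (hn _), diagram_adj_none_some]
  · simp [hinc (hq _) (hl _), diagram_adj_some_some]
  · simp [hinc (hq _) (hm _), diagram_adj_some_some]
  · simp [hinc (hq _) (hn _), diagram_adj_some_some]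
  · simp [hinc (hs _) (hl _), diagram_adj_some_some]
  · simp [hinc (hs _) (hm _), diagram_adj_some_some]
  · simp [hinc (hs _) (hn _), diagram_adj_some_some]
  · intro a h
    have : f (some (a, 1)) = f (some (a, 3)) := by rw [hq, hs, h]
    simpa using f.injective this
  · intro a h
    have : f (some (a, 2)) = f (some (a, 4)) := by rw [hm, hn, h]
    simpa using f.injective this

set_option synthInstance.maxHeartbeats 200000 in
set_option synthInstance.maxSize 1000 in
/-- Every point-centered diagram is the image of the standard one under a collineation. -/
theorem exists_collineation (f : diagram ↪g incidenceGraph) {p : Point} (hp : f none = .inl p) :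
    ∃ φ : cyclicGraph ≃g incidenceGraph, f none = φ (.inl 10) ∧
      (∀ a, f (some (a, 0)) = φ (.inr (![12, 4, 3] a))) ∧
      (∀ a, f (some (a, 1)) = φ (.inl (![4, 12, 0] a))) ∧
      (∀ a, f (some (a, 2)) = φ (.inr (![5, 2, 0] a))) ∧
      (∀ a, f (some (a, 3)) = φ (.inl (![8, 7, 3] a))) ∧
      ∀ a, f (some (a, 4)) = φ (.inr (![8, 7, 11] a)) := by
  obtain ⟨y, rfl, hl, hq, hm, hs, hn⟩ := exists_pointCentered f hp
  obtain ⟨g, hgp, hg0, hg1, hg2⟩ := exists_smul_eq_of_lines (q₂ := y.q 2) (y.p_l 0) (y.p_l 1)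
    ((y.q_l 0 0).2 rfl) ((y.q_l 1 1).2 rfl) (mt (y.q_l 0 1).1 (by decide))
    (mt (y.q_l 1 0).1 (by decide)) (mt (y.q_l 2 0).1 (by decide)) (mt (y.q_l 2 1).1 (by decide))
  have toL (l : Point) : ∃ j, contragredient g • cyclicEquiv j = l :=
    ⟨cyclicEquiv.symm ((contragredient g)⁻¹ • l), by simp⟩
  have toP (p : Point) : ∃ i, g • cyclicEquiv i = p :=
    ⟨cyclicEquiv.symm (g⁻¹ • p), by simp⟩
  obtain ⟨p, l, q, m, s, n, p_l, p_m, p_n, q_l, q_m, q_n, s_l, s_m, s_n, qs, mn⟩ := y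
  dsimp only at *
  choose l' hl' using fun a => toL (l a)
  choose q' hq' using fun a => toP (q a)
  choose m' hm' using fun a => toL (m a)
  choose s' hs' using fun a => toP (s a)
  choose n' hn' using fun a => toL (n a)
  obtain rfl : _ = l := funext hl'
  obtain rfl : _ = q := funext hq'
  obtain rfl : _ = m := funext hm'
  obtain rfl : _ = s := funext hs'
  obtain rfl : _ = n := funext hn'
  subst hgp
  -- Pulling everything back by `g` turns the conditions into statements about labels in `Fin 13`,
  -- which can be decided.
  simp only [smul_mem_pointsOn_smul, cyclicEquiv_mem_pointsOn, smul_left_cancel_iff, ne_eq,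
    cyclicEquiv.apply_eq_iff_eq] at *
  have hline (j q : Fin 13) (k : Fin 13) (hjq : cyclicInc q j) (hj : cyclicInc 10 j)
      (hq : q = 4 ∧ k = 12 ∨ q = 12 ∧ k = 4 ∨ q = 0 ∧ k = 3 ∨ q = 6 ∧ k = 3) : j = k := by
    revert j q k; decide +kernel
  have l0 := hline (l' 0) 4 12 (hg0 ▸ (q_l 0 0).2 rfl) (p_l 0) (by simp)
  have l1 := hline (l' 1) 12 4 (hg1 ▸ (q_l 1 1).2 rfl) (p_l 1) (by simp)
  rcases hg2 with hg2 | hg2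
  · have l2 := hline (l' 2) 0 3 (hg2 ▸ (q_l 2 2).2 rfl) (p_l 2) (by simp)
    -- The points `q a` are not collinear here. Of the four lines through `q a`, one passes through
    -- `p` and two through the other `q b`, so `m a` is the remaining one; the finite check shows
    -- that `s a` and `n a` are then forced as well.
    have arm0 : ∀ m s n : Fin 13, cyclicInc 4 m → ¬ cyclicInc 10 m → ¬ cyclicInc 12 m →
        ¬ cyclicInc 0 m → cyclicInc s m → ¬ 4 = s → ¬ cyclicInc s 4 → ¬ cyclicInc s 3 →
        cyclicInc s n → ¬ m = n → ¬ cyclicInc 10 n → ¬ cyclicInc 12 n → ¬ cyclicInc 0 n →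
        m = 5 ∧ s = 8 ∧ n = 8 := by decide +kernel
    have arm1 : ∀ m s n : Fin 13, cyclicInc 12 m → ¬ cyclicInc 10 m → ¬ cyclicInc 4 m →
        ¬ cyclicInc 0 m → cyclicInc s m → ¬ 12 = s → ¬ cyclicInc s 12 → ¬ cyclicInc s 3 →
        cyclicInc s n → ¬ m = n → ¬ cyclicInc 10 n → ¬ cyclicInc 4 n → ¬ cyclicInc 0 n →
        m = 2 ∧ s = 7 ∧ n = 7 := by decide +kernel
    have arm2 : ∀ m s n : Fin 13, cyclicInc 0 m → ¬ cyclicInc 10 m → ¬ cyclicInc 4 m →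
        ¬ cyclicInc 12 m → cyclicInc s m → ¬ 0 = s → ¬ cyclicInc s 12 → ¬ cyclicInc s 4 →
        cyclicInc s n → ¬ m = n → ¬ cyclicInc 10 n → ¬ cyclicInc 4 n → ¬ cyclicInc 12 n →
        m = 0 ∧ s = 3 ∧ n = 11 := by decide +kernel
    obtain ⟨m0, s0, n0⟩ := arm0 (m' 0) (s' 0) (n' 0) (hg0 ▸ (q_m 0 0).2 rfl) (p_m 0)
      (hg1 ▸ mt (q_m 1 0).1 (by decide)) (hg2 ▸ mt (q_m 2 0).1 (by decide)) ((s_m 0 0).2 rfl)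
      (hg0 ▸ qs 0) (l1 ▸ s_l 0 1) (l2 ▸ s_l 0 2) ((s_n 0 0).2 rfl) (mn 0) (p_n 0)
      (hg1 ▸ q_n 1 0) (hg2 ▸ q_n 2 0)
    obtain ⟨m1, s1, n1⟩ := arm1 (m' 1) (s' 1) (n' 1) (hg1 ▸ (q_m 1 1).2 rfl) (p_m 1)
      (hg0 ▸ mt (q_m 0 1).1 (by decide)) (hg2 ▸ mt (q_m 2 1).1 (by decide)) ((s_m 1 1).2 rfl)
      (hg1 ▸ qs 1) (l0 ▸ s_l 1 0) (l2 ▸ s_l 1 2) ((s_n 1 1).2 rfl) (mn 1) (p_n 1)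
      (hg0 ▸ q_n 0 1) (hg2 ▸ q_n 2 1)
    obtain ⟨m2, s2, n2⟩ := arm2 (m' 2) (s' 2) (n' 2) (hg2 ▸ (q_m 2 2).2 rfl) (p_m 2)
      (hg0 ▸ mt (q_m 0 2).1 (by decide)) (hg1 ▸ mt (q_m 1 2).1 (by decide)) ((s_m 2 2).2 rfl)
      (hg2 ▸ qs 2) (l0 ▸ s_l 2 0) (l1 ▸ s_l 2 1) ((s_n 2 2).2 rfl) (mn 2) (p_n 2)
      (hg0 ▸ q_n 0 2) (hg1 ▸ q_n 1 2)
    have vec {u : Fin 3 → Fin 13} {x y z : Fin 13} (h0 : u 0 = x) (h1 : u 1 = y) (h2 : u 2 = z) :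
        u = ![x, y, z] := by
      ext i
      fin_cases i <;> simp [h0, h1, h2]
    rw [vec l0 l1 l2] at hl
    rw [vec hg0.symm hg1.symm hg2.symm] at hq
    rw [vec m0 m1 m2] at hm
    rw [vec s0 s1 s2] at hs
    rw [vec n0 n1 n2] at hn
    exact ⟨cyclicIso.trans (collineation g), hp, hl, hq, hm, hs, hn⟩
  -- Here `q 0`, `q 1`, `q 2` lie on one line (labels 4, 12, 6). The point `s 0` must lie on the
  -- fourth line through `p`, so every line through `s 0` contains `p` or some `q b`, and no `n 0`
  -- exists.
  · have arm : ∀ m s n : Fin 13, cyclicInc 4 m → ¬ cyclicInc 10 m → ¬ cyclicInc 12 m →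
        ¬ cyclicInc 6 m → cyclicInc s m → ¬ 4 = s → ¬ cyclicInc s 4 → ¬ cyclicInc s 3 →
        cyclicInc s n → ¬ m = n → ¬ cyclicInc 10 n → ¬ cyclicInc 12 n → ¬ cyclicInc 6 n →
        ¬ cyclicInc 4 n → False := by decide +kernel
    have l2 := hline (l' 2) 6 3 (hg2 ▸ (q_l 2 2).2 rfl) (p_l 2) (by simp)
    exact (arm (m' 0) (s' 0) (n' 0) (hg0 ▸ (q_m 0 0).2 rfl) (p_m 0)
      (hg1 ▸ mt (q_m 1 0).1 (by decide)) (hg2 ▸ mt (q_m 2 0).1 (by decide)) ((s_m 0 0).2 rfl)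
      (hg0 ▸ qs 0) (l1 ▸ s_l 0 1) (l2 ▸ s_l 0 2) ((s_n 0 0).2 rfl) (mn 0) (p_n 0)
      (hg1 ▸ q_n 1 0) (hg2 ▸ q_n 2 0) (hg0 ▸ q_n 0 0)).elim

/-! ### Completing `12`-gons -/

/-- A set of nodes of a graph is `12`-gon closed if it contains every node that completes `11` of its
elements to an induced `12`-gon. -/
def GonClosed {α : Type*} (G : SimpleGraph α) (T : Set α) : Prop :=
  ∀ g : SimpleGraph.cycleGraph 12 ↪g G, (∀ i ≠ 0, g i ∈ T) → g 0 ∈ T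

theorem GonClosed.preimage {α β : Type*} {G : SimpleGraph α} {H : SimpleGraph β} {T : Set β}
    (hT : GonClosed H T) (φ : G ≃g H) : GonClosed G (φ ⁻¹' T) := fun g hg =>
  hT (g.trans φ.toRelEmbedding) hg

theorem GonClosed.mem_of_gon {T : Set (Fin 13 ⊕ Fin 13)} (hT : GonClosed cyclicGraph T)
    (u : Fin 12 → Fin 13 ⊕ Fin 13)
    (hu : (∀ i j, u i = u j → i = j) ∧
      ∀ i j, cyclicGraph.Adj (u i) (u j) ↔ (i - j = 1 ∨ j - i = 1))
    (h : ∀ i : Fin 11, u i.succ ∈ T) : u 0 ∈ T :=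
  hT ⟨⟨u, fun {i j} => hu.1 i j⟩, fun {i j} => (hu.2 i j).trans SimpleGraph.cycleGraph_adj.symm⟩
    fun i hi => by
      obtain ⟨j, rfl⟩ := Fin.exists_succ_eq.2 hi
      exact h j

/-- Completing `12`-gons, one reaches all nodes from the standard `Y₅₅₅` diagram. -/
theorem GonClosed.eq_univ_of_standard {T : Set (Fin 13 ⊕ Fin 13)} (hT : GonClosed cyclicGraph T)
    (p10 : .inl 10 ∈ T) (hl : ∀ a, .inr (![12, 4, 3] a) ∈ T)
    (hq : ∀ a, .inl (![4, 12, 0] a) ∈ T) (hm : ∀ a, .inr (![5, 2, 0] a) ∈ T)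
    (hs : ∀ a, .inl (![8, 7, 3] a) ∈ T) (hn : ∀ a, .inr (![8, 7, 11] a) ∈ T) :
    T = Set.univ := by
  simp only [Fin.forall_fin_succ, cons_val_zero, cons_val_succ, IsEmpty.forall_iff,
    and_true] at hl hq hm hs hn
  obtain ⟨l12, l4, l3⟩ := hl
  obtain ⟨p4, p12, p0⟩ := hq
  obtain ⟨l5, l2, l0⟩ := hm
  obtain ⟨p8, p7, p3⟩ := hs
  obtain ⟨l8, l7, l11⟩ := hn
  -- Each list below is an induced 12-gon in cyclic order; its first node is new, and the other
  -- eleven are already known to lie in `T`.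
  have p2 : .inl 2 ∈ T := hT.mem_of_gon
    ![.inl 2, .inr 7, .inl 7, .inr 2, .inl 12, .inr 4, .inl 10, .inr 3,
      .inl 0, .inr 0, .inl 3, .inr 11] (by decide +kernel) (by
      simp only [Fin.forall_fin_succ, cons_val_succ, cons_val_zero, IsEmpty.forall_iff, and_true]
      exact ⟨l7, p7, l2, p12, l4, p10, l3, p0, l0, p3, l11⟩)
  have p5 : .inl 5 ∈ T := hT.mem_of_gon
    ![.inl 5, .inr 4, .inl 12, .inr 2, .inl 7, .inr 7, .inl 2, .inr 12,
      .inl 4, .inr 5, .inl 8, .inr 8] (by decide +kernel) (by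
      simp only [Fin.forall_fin_succ, cons_val_succ, cons_val_zero, IsEmpty.forall_iff, and_true]
      exact ⟨l4, p12, l2, p7, l7, p2, l12, p4, l5, p8, l8⟩)
  have p1 : .inl 1 ∈ T := hT.mem_of_gon
    ![.inl 1, .inr 0, .inl 0, .inr 3, .inl 10, .inr 4, .inl 5, .inr 11,
      .inl 2, .inr 7, .inl 7, .inr 2] (by decide +kernel) (by
      simp only [Fin.forall_fin_succ, cons_val_succ, cons_val_zero, IsEmpty.forall_iff, and_true]
      exact ⟨l0, p0, l3, p10, l4, p5, l11, p2, l7, p7, l2⟩)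
  have p6 : .inl 6 ∈ T := hT.mem_of_gon
    ![.inl 6, .inr 3, .inl 0, .inr 0, .inl 1, .inr 2, .inl 12, .inr 4,
      .inl 5, .inr 11, .inl 2, .inr 7] (by decide +kernel) (by
      simp only [Fin.forall_fin_succ, cons_val_succ, cons_val_zero, IsEmpty.forall_iff, and_true]
      exact ⟨l3, p0, l0, p1, l2, p12, l4, p5, l11, p2, l7⟩)
  have p9 : .inl 9 ∈ T := hT.mem_of_gon
    ![.inl 9, .inr 0, .inl 0, .inr 3, .inl 6, .inr 8, .inl 5, .inr 11,
      .inl 2, .inr 12, .inl 4, .inr 5] (by decide +kernel) (by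
      simp only [Fin.forall_fin_succ, cons_val_succ, cons_val_zero, IsEmpty.forall_iff, and_true]
      exact ⟨l0, p0, l3, p6, l8, p5, l11, p2, l12, p4, l5⟩)
  have p11 : .inl 11 ∈ T := hT.mem_of_gon
    ![.inl 11, .inr 2, .inl 7, .inr 7, .inl 2, .inr 12, .inl 10, .inr 4,
      .inl 5, .inr 8, .inl 8, .inr 5] (by decide +kernel) (by
      simp only [Fin.forall_fin_succ, cons_val_succ, cons_val_zero, IsEmpty.forall_iff, and_true]
      exact ⟨l2, p7, l7, p2, l12, p10, l4, p5, l8, p8, l5⟩)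
  have l1 : .inr 1 ∈ T := hT.mem_of_gon
    ![.inr 1, .inl 0, .inr 0, .inl 1, .inr 12, .inl 4, .inr 5, .inl 11,
      .inr 11, .inl 5, .inr 4, .inl 12] (by decide +kernel) (by
      simp only [Fin.forall_fin_succ, cons_val_succ, cons_val_zero, IsEmpty.forall_iff, and_true]
      exact ⟨p0, l0, p1, l12, p4, l5, p11, l11, p5, l4, p12⟩)
  have l6 : .inr 6 ∈ T := hT.mem_of_gon
    ![.inr 6, .inl 3, .inr 0, .inl 0, .inr 1, .inl 2, .inr 7, .inl 6,
      .inr 8, .inl 5, .inr 4, .inl 10] (by decide +kernel) (by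
      simp only [Fin.forall_fin_succ, cons_val_succ, cons_val_zero, IsEmpty.forall_iff, and_true]
      exact ⟨p3, l0, p0, l1, p2, l7, p6, l8, p5, l4, p10⟩)
  have l9 : .inr 9 ∈ T := hT.mem_of_gon
    ![.inr 9, .inl 0, .inr 0, .inl 1, .inr 2, .inl 11, .inr 5, .inl 8,
      .inr 6, .inl 10, .inr 4, .inl 5] (by decide +kernel) (by
      simp only [Fin.forall_fin_succ, cons_val_succ, cons_val_zero, IsEmpty.forall_iff, and_true]
      exact ⟨p0, l0, p1, l2, p11, l5, p8, l6, p10, l4, p5⟩)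
  have l10 : .inr 10 ∈ T := hT.mem_of_gon
    ![.inr 10, .inl 3, .inr 0, .inl 0, .inr 1, .inl 2, .inr 7, .inl 7,
      .inr 2, .inl 11, .inr 5, .inl 4] (by decide +kernel) (by
      simp only [Fin.forall_fin_succ, cons_val_succ, cons_val_zero, IsEmpty.forall_iff, and_true]
      exact ⟨p3, l0, p0, l1, p2, l7, p7, l2, p11, l5, p4⟩)
  refine Set.eq_univ_of_forall ?_
  rintro (i | i) <;> fin_cases i <;> assumption

/-- Completing `12`-gons, one reaches all of the incidence graph from any `Y₅₅₅` diagram. -/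
theorem GonClosed.eq_univ {T : Set (Point ⊕ Line)} (hT : GonClosed incidenceGraph T)
    (f : diagram ↪g incidenceGraph) (hf : ∀ i, f i ∈ T) : T = Set.univ := by
  have main {T : Set (Point ⊕ Line)} (hT : GonClosed incidenceGraph T)
      (f : diagram ↪g incidenceGraph) (hf : ∀ i, f i ∈ T) {p : Point} (hp : f none = .inl p) :
      T = Set.univ := by
    obtain ⟨φ, hp, hl, hq, hm, hs, hn⟩ := exists_collineation f hp
    have hφ {u x} (h : f u = φ x) : x ∈ φ ⁻¹' T := by
      rw [Set.mem_preimage, ← h]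
      exact hf u
    have := (hT.preimage φ).eq_univ_of_standard (hφ hp) (fun a => hφ (hl a)) (fun a => hφ (hq a))
      (fun a => hφ (hm a)) (fun a => hφ (hs a)) (fun a => hφ (hn a))
    rwa [Set.preimage_eq_univ_iff, φ.surjective.range_eq, Set.univ_subset_iff] at this
  rcases h : f none with p | l
  · exact main hT f hf h
  -- A diagram centered at a line becomes point-centered under the polarity.
  · have := main (hT.preimage polarity) (f.trans polarity.symm.toRelEmbedding)
      (fun i => (congrArg (· ∈ T) (polarity.apply_symm_apply (f i))).mpr (hf i)) (p := l)
      (congrArg polarity.symm h)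
    rwa [Set.preimage_eq_univ_iff, polarity.surjective.range_eq, Set.univ_subset_iff] at this

/-! ### Existence of an embedding -/

/-- The standard `Y₅₅₅` diagram in the cyclic model. -/
def standardNode : Option (Fin 3 × Fin 5) → Fin 13 ⊕ Fin 13
  | none => .inl 10
  | some (a, i) => ![.inr (![12, 4, 3] a), .inl (![4, 12, 0] a), .inr (![5, 2, 0] a),
      .inl (![8, 7, 3] a), .inr (![8, 7, 11] a)] i

/-- The `Y₅₅₅` diagram embeds in the incidence graph. -/
theorem nonempty_diagram_embedding : Nonempty (diagram ↪g incidenceGraph) := by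
  have hinj : ∀ u v, standardNode u = standardNode v → u = v := by decide +kernel
  have hadj₀ : ∀ a i, cyclicGraph.Adj (standardNode none) (standardNode (some (a, i))) ↔ i = 0 := by
    decide +kernel
  have hadj : ∀ a i b j, cyclicGraph.Adj (standardNode (some (a, i))) (standardNode (some (b, j))) ↔
      a = b ∧ (j.val = i.val + 1 ∨ i.val = j.val + 1) := by
    decide +kernel
  refine ⟨(RelEmbedding.mk ⟨standardNode, fun {u v} => hinj u v⟩ ?_ :
    diagram ↪g cyclicGraph).trans cyclicIso.toRelEmbedding⟩
  rintro (_ | ⟨a, i⟩) (_ | ⟨b, j⟩)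
  · simp
  · exact (hadj₀ b j).trans diagram_adj_none_some.symm
  · rw [cyclicGraph.adj_comm, diagram.adj_comm]
    exact (hadj₀ a i).trans diagram_adj_none_some.symm
  · exact (hadj a i b j).trans diagram_adj_some_some.symm

/-! ### The Hermitian form and reflections -/

theorem conj_ω : conj ω = -1 - ω := by
  have h := θ_eq
  rw [θ] at h
  linear_combination -h

theorem conj_θ : conj θ = -θ := by
  rw [θ_eq, map_add, map_mul, conj_ω, map_one, map_ofNat]
  ring

theorem θ_mul_θ : θ * θ = -3 := by
  rw [θ_eq]
  linear_combination 4 * ω_sq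

theorem ω_mem : ω ∈ Eis := ⟨0, 1, by simp⟩

theorem ωUnit_val : (ωUnit : ℂ) = ω := rfl

theorem herm_symm (x y : V) : herm y x = conj (herm x y) := by
  simp only [herm, map_add, map_neg, map_mul, map_sum, Complex.conj_conj, mul_comm]

theorem herm_smul_right (a : ℂ) (x y : V) : herm x (a • y) = conj a * herm x y := by
  rw [herm_symm, herm_smul_left, map_mul, ← herm_symm]

theorem herm_add_right (x y z : V) : herm x (y + z) = herm x y + herm x z := by
  rw [herm_symm, herm_add_left, map_add, ← herm_symm, ← herm_symm]

theorem herm_zero_left (x : V) : herm 0 x = 0 := by simp [herm]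

theorem herm_sum_left {ι : Type*} (s : Finset ι) (f : ι → V) (y : V) :
    herm (∑ i ∈ s, f i) y = ∑ i ∈ s, herm (f i) y := by
  induction s using Finset.cons_induction with
  | empty => simp [herm_zero_left]
  | cons i s hi ih => rw [Finset.sum_cons, Finset.sum_cons, herm_add_left, ih]

theorem herm_sum_right {ι : Type*} (s : Finset ι) (f : ι → V) (y : V) :
    herm y (∑ i ∈ s, f i) = ∑ i ∈ s, herm y (f i) := by
  rw [herm_symm, herm_sum_left, map_sum]
  simp only [← herm_symm]

theorem reflection_apply (ζ : ℂˣ) (r x : V) :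
    reflection ζ r x = x + (((ζ : ℂ) - 1) * (herm x r / herm r r)) • r := rfl

/-- The factors `c` and `conj c` cancel against those in the norm. Signs and units of roots can thus
be ignored when only reflections matter. -/
theorem reflection_smul (ζ : ℂˣ) {c : ℂ} (hc : c ≠ 0) (r : V) :
    reflection ζ (c • r) = reflection ζ r := by
  ext1 x
  have hc' : conj c ≠ 0 := (map_ne_zero _).2 hc
  rw [reflection_apply, reflection_apply, smul_smul, herm_smul_right, herm_smul_right,
    herm_smul_left]
  congr 2
  by_cases hr : herm r r = 0
  · simp [hr]
  · field_simp

/-- Conjugating a reflection by an isometry. -/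
theorem mul_reflection_mul_inv (g : V ≃ₗ[ℂ] V) (hg : ∀ x y, herm (g x) (g y) = herm x y) (ζ : ℂˣ)
    (r : V) : g * reflection ζ r * g⁻¹ = reflection ζ (g r) := by
  ext1 x
  obtain ⟨y, rfl⟩ := g.surjective x
  have : g⁻¹ (g y) = y := g.symm_apply_apply y
  simp only [LinearEquiv.mul_apply, this, reflection_apply, map_add, map_smul, hg]

theorem herm_reflection {r : V} (hr : herm r r = 3) (x y : V) :
    herm (reflection ωUnit r x) (reflection ωUnit r y) = herm x y := by
  simp only [reflection_apply, herm_add_left, herm_add_right, herm_smul_left, herm_smul_right, hr,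
    map_mul, map_sub, map_one, map_div₀, map_ofNat, ← herm_symm, ωUnit_val, conj_ω]
  linear_combination (herm x r * herm r y / 3) * (-1 : ℂ) * ω_sq

theorem reflection_inv (ζ : ℂˣ) (r : V) : (reflection ζ r)⁻¹ = reflection ζ⁻¹ r := rfl

/-! ### Inner products of roots -/

theorem herm_pointRoot_right (x : V) (p : Point) : herm x (pointRoot p) = -θ * x.2 p := by
  classical
  simp [herm, pointRoot, Pi.single_apply, apply_ite conj, conj_θ, mul_comm]

theorem herm_lineRoot_right (x : V) (l : Line) :
    herm x (lineRoot l) = -x.1 + ∑ p, (pointsOn l).indicator x.2 p := by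
  classical
  simp [herm, lineRoot, Set.indicator_apply, apply_ite conj]

theorem lineRoot_snd_apply (l : Line) (p : Point) [Decidable (p ∈ pointsOn l)] :
    (lineRoot l).2 p = if p ∈ pointsOn l then 1 else 0 := by
  classical
  simp only [lineRoot, Set.indicator_apply, Pi.one_apply]

theorem pointRoot_snd_apply (p q : Point) [Decidable (q = p)] :
    (pointRoot p).2 q = if q = p then θ else 0 := by
  classical
  simp only [pointRoot, Pi.single_apply]
  congr

theorem herm_pointRoot_pointRoot (p q : Point) [Decidable (p = q)] :
    herm (pointRoot p) (pointRoot q) = if p = q then 3 else 0 := by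
  classical
  rw [herm_pointRoot_right, pointRoot_snd_apply]
  simp only [eq_comm (a := q)]
  split_ifs
  · linear_combination -θ_mul_θ
  · ring

theorem herm_lineRoot_pointRoot (l : Line) (p : Point) [Decidable (p ∈ pointsOn l)] :
    herm (lineRoot l) (pointRoot p) = if p ∈ pointsOn l then -θ else 0 := by
  rw [herm_pointRoot_right, lineRoot_snd_apply]
  split_ifs <;> ring

theorem herm_pointRoot_lineRoot (p : Point) (l : Line) [Decidable (p ∈ pointsOn l)] :
    herm (pointRoot p) (lineRoot l) = if p ∈ pointsOn l then θ else 0 := by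
  rw [herm_symm, herm_lineRoot_pointRoot]
  split_ifs <;> simp [conj_θ]

/-- This is the perfect difference set property. With the contribution `-1` of the first coordinates
it yields the inner products `4 - 1 = 3` and `1 - 1 = 0` of line roots. -/
theorem sum_cyclicInc_mul (i j : Fin 13) :
    (∑ k, if cyclicInc k i ∧ cyclicInc k j then 1 else 0 : ℕ) = if i = j then 4 else 1 := by
  revert i j; decide +kernel

theorem herm_lineRoot_lineRoot (l m : Line) [Decidable (l = m)] :
    herm (lineRoot l) (lineRoot m) = if l = m then 3 else 0 := by
  classical
  obtain ⟨i, rfl⟩ := cyclicEquiv.surjective l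
  obtain ⟨j, rfl⟩ := cyclicEquiv.surjective m
  have := congrArg (Nat.cast (R := ℂ)) (sum_cyclicInc_mul j i)
  rw [herm_lineRoot_right, ← cyclicEquiv.sum_comp]
  simp only [Set.indicator_apply, lineRoot_snd_apply, cyclicEquiv_mem_pointsOn, ← ite_and]
  push_cast at this
  rw [this]
  simp only [lineRoot, cyclicEquiv.apply_eq_iff_eq, eq_comm (a := i)]
  split_ifs <;> norm_num

/-- The inner products of the roots. -/
theorem herm_root_root (u v : Point ⊕ Line) [Decidable (u = v)]
    [Decidable (incidenceGraph.Adj u v)] :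
    herm (root u) (root v) =
      if u = v then 3 else if incidenceGraph.Adj u v then (if u.isLeft then θ else -θ) else 0 := by
  classical
  rcases u with p | l <;> rcases v with q | m <;>
    simp [root, herm_pointRoot_pointRoot, herm_lineRoot_pointRoot, herm_pointRoot_lineRoot,
      herm_lineRoot_lineRoot]

theorem herm_root_self (u : Point ⊕ Line) : herm (root u) (root u) = 3 := by
  classical
  rw [herm_root_root, if_pos rfl]

/-! ### Chains and `12`-gons of roots -/

/-- In a chain `r₁, …, rₙ` of roots with consecutive inner products `θ`, the group generated by the
reflections in the `rᵢ` contains the reflection in `r₁ + ω̄ r₂ + ⋯ + ω̄ⁿ⁻¹ rₙ`. -/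
theorem reflection_sum_mem (H : Subgroup (V ≃ₗ[ℂ] V)) (r : ℕ → V) (n : ℕ)
    (h3 : ∀ i ≤ n, herm (r i) (r i) = 3) (hθ : ∀ i < n, herm (r i) (r (i + 1)) = θ)
    (h0 : ∀ i j, i + 1 < j → j ≤ n → herm (r i) (r j) = 0)
    (hH : ∀ i ≤ n, reflection ωUnit (r i) ∈ H) :
    reflection ωUnit (∑ j ∈ Finset.range (n + 1), (ω ^ 2) ^ j • r j) ∈ H := by
  induction n with
  | zero => simpa using hH 0 le_rfl
  | succ n ih =>
    have ih := ih (fun i hi => h3 i (by omega)) (fun i hi => hθ i (by omega))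
      (fun i j hi hj => h0 i j hi (by omega)) (fun i hi => hH i (by omega))
    have hn := hH (n + 1) le_rfl
    -- Only the last term of the partial sum meets `r (n + 1)`, and `(ω - 1) * θ / 3 = ω ^ 2`, so
    -- the reflection adds exactly the next term.
    have key : reflection ωUnit (r (n + 1)) (∑ j ∈ Finset.range (n + 1), (ω ^ 2) ^ j • r j) =
        ∑ j ∈ Finset.range (n + 1 + 1), (ω ^ 2) ^ j • r j := by
      have hz : ∑ j ∈ Finset.range n, herm ((ω ^ 2) ^ j • r j) (r (n + 1)) = 0 := by
        refine Finset.sum_eq_zero fun j hj => ?_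
        rw [herm_smul_left, h0 j (n + 1) (by simpa using hj) le_rfl, mul_zero]
      rw [reflection_apply, Finset.sum_range_succ _ (n + 1), herm_sum_left,
        Finset.sum_range_succ (fun j => herm _ _), hz, herm_smul_left, hθ n (by omega), h3 _ le_rfl, ωUnit_val, pow_succ]
      congr 2
      rw [θ_eq]
      linear_combination ((-1 / 3 : ℂ) * (ω ^ 2) ^ n) * ω_sq
    rw [← key, ← mul_reflection_mul_inv _ (herm_reflection (h3 _ le_rfl))]
    exact H.mul_mem (H.mul_mem hn ih) (H.inv_mem hn)

/-- The sign by which the `i`-th root of a `12`-gon is multiplied to make all consecutive inner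
products equal to `θ`. -/
def gonSign (b : Bool) : Fin 12 → ℂ :=
  -- The inner product is `θ` from point to line and `-θ` from line to point, so the sign changes at
  -- every second step. The pattern has period 4 and closes up because 4 divides 12.
  if b then ![1, 1, -1, -1, 1, 1, -1, -1, 1, 1, -1, -1]
  else ![1, -1, -1, 1, 1, -1, -1, 1, 1, -1, -1, 1]

/-- The roots of a `12`-gon, with signs that make all consecutive inner products equal to `θ`. -/
def gonRoot (g : SimpleGraph.cycleGraph 12 ↪g incidenceGraph) (i : Fin 12) : V :=
  gonSign (g 0).isLeft i • root (g i)

theorem gonSign_mul_self (b : Bool) (i : Fin 12) : gonSign b i * gonSign b i = 1 := by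
  cases b <;> fin_cases i <;> simp [gonSign]

theorem gonSign_eq (b : Bool) (i : Fin 12) : gonSign b i = 1 ∨ gonSign b i = -1 := by
  rw [← mul_self_eq_one_iff, gonSign_mul_self]

theorem gonSign_ne_zero (b : Bool) (i : Fin 12) : gonSign b i ≠ 0 :=
  left_ne_zero_of_mul_eq_one (gonSign_mul_self b i)

theorem conj_gonSign (b : Bool) (i : Fin 12) : conj (gonSign b i) = gonSign b i := by
  rcases gonSign_eq b i with h | h <;> simp [h]

theorem isLeft_gon (g : SimpleGraph.cycleGraph 12 ↪g incidenceGraph) (i : Fin 12) :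
    (g i).isLeft = xor (g 0).isLeft (decide (i.val % 2 = 1)) := by
  have step (i j : Fin 12) (h : i - j = 1) : (g i).isLeft = !(g j).isLeft := by
    have : incidenceGraph.Adj (g i) (g j) :=
      g.map_rel_iff.2 (SimpleGraph.cycleGraph_adj.2 (.inl h))
    rcases hi : g i with p | l <;> rcases hj : g j with q | m <;> simp_all
  have sub : ∀ i : Fin 11, i.succ - i.castSucc = 1 := by decide
  have odd : ∀ i : Fin 11, (!decide (i.castSucc.val % 2 = 1)) = decide (i.succ.val % 2 = 1) := by
    decide
  induction i using Fin.induction with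
  | zero => simp
  | succ i ih => rw [step _ _ (sub i), ih, ← Bool.xor_not, odd]

theorem herm_gonRoot_self (g : SimpleGraph.cycleGraph 12 ↪g incidenceGraph) (i : Fin 12) :
    herm (gonRoot g i) (gonRoot g i) = 3 := by
  rw [gonRoot, herm_smul_left, herm_smul_right, herm_root_self, conj_gonSign]
  linear_combination 3 * gonSign_mul_self (g 0).isLeft i

theorem herm_gonRoot_succ (g : SimpleGraph.cycleGraph 12 ↪g incidenceGraph) (i j : Fin 12)
    (h : j - i = 1) : herm (gonRoot g i) (gonRoot g j) = θ := by
  classical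
  have hadj : incidenceGraph.Adj (g i) (g j) :=
    g.map_rel_iff.2 (SimpleGraph.cycleGraph_adj.2 (.inr h))
  have hleft := isLeft_gon g i
  rw [gonRoot, gonRoot, herm_smul_left, herm_smul_right, herm_root_root, if_neg hadj.ne, if_pos hadj,
    conj_gonSign]
  obtain rfl : j = i + 1 := by rw [← h]; simp
  generalize (g 0).isLeft = b at *
  rw [hleft]
  clear h hadj hleft
  cases b <;> fin_cases i <;> simp [gonSign]

theorem herm_gonRoot_eq_zero (g : SimpleGraph.cycleGraph 12 ↪g incidenceGraph) {i j : Fin 12}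
    (hij : i ≠ j) (h : i - j ≠ 1) (h' : j - i ≠ 1) : herm (gonRoot g i) (gonRoot g j) = 0 := by
  classical
  have hadj : ¬ incidenceGraph.Adj (g i) (g j) := by
    rw [g.map_rel_iff, SimpleGraph.cycleGraph_adj]
    tauto
  rw [gonRoot, gonRoot, herm_smul_left, herm_smul_right, herm_root_root,
    if_neg (g.injective.ne hij), if_neg hadj, mul_zero, mul_zero]

theorem herm_gonRoot (g : SimpleGraph.cycleGraph 12 ↪g incidenceGraph) (i j : Fin 12) :
    herm (gonRoot g i) (gonRoot g j) =
      (if i = j then 3 else 0) + (if i = j - 1 then θ else 0) + if i = j + 1 then -θ else 0 := by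
  have h₁ : ∀ i : Fin 12, i ≠ i - 1 ∧ i ≠ i + 1 ∧ i - 1 ≠ i ∧ i + 1 ≠ i ∧ i - 1 ≠ i + 1 ∧
      i + 1 ≠ i - 1 := by decide
  obtain ⟨h₁, h₂, h₃, h₄, h₅, h₆⟩ := h₁ j
  by_cases h : i = j
  · subst h
    simp [herm_gonRoot_self, h₁, h₂]
  by_cases h' : i = j - 1
  · subst h'
    simp [herm_gonRoot_succ g (j - 1) j, h₃, h₅]
  by_cases h'' : i = j + 1
  · subst h''
    rw [herm_symm, herm_gonRoot_succ g j (j + 1) (by simp), conj_θ]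
    simp [h₄, h₆]
  · rw [herm_gonRoot_eq_zero g h, if_neg h, if_neg h', if_neg h'']
    · ring
    · intro e
      exact h'' (by rw [← e]; simp)
    · intro e
      exact h' (by rw [← e]; simp)

/-- A vector with first coordinate zero is zero if its norm is. -/
theorem eq_zero_of_herm_self {x : V} (h₁ : x.1 = 0) (h : herm x x = 0) : x = 0 := by
  rw [herm, h₁, zero_mul, neg_zero, zero_add] at h
  simp only [Complex.mul_conj] at h
  have h' : ∑ p, Complex.normSq (x.2 p) = 0 := by exact_mod_cast h
  rw [Finset.sum_eq_zero_iff_of_nonneg fun p _ => Complex.normSq_nonneg _] at h'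
  exact Prod.ext h₁ (funext fun p => Complex.normSq_eq_zero.1 (h' p (Finset.mem_univ p)))

/-- The linear relation between the roots of a `12`-gon. -/
theorem sum_gonRoot (g : SimpleGraph.cycleGraph 12 ↪g incidenceGraph) :
    ∑ i : Fin 12, (ω ^ 2) ^ i.val • gonRoot g i = 0 := by
  -- The first coordinate collects the six line roots, which have alternating signs. Up to a common
  -- factor it is the sum of the powers `(-ω) ^ j` for `j < 6`, which is 0 because `-ω` is a
  -- primitive sixth root of unity.
  apply eq_zero_of_herm_self
  · have hroot (u : Point ⊕ Line) : (root u).1 = if u.isLeft then 0 else 1 := by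
      rcases u with p | l <;> simp [root, pointRoot, lineRoot]
    have hleft := isLeft_gon g
    rw [Prod.fst_sum]
    simp only [gonRoot, Prod.smul_fst, hroot, smul_eq_mul]
    generalize (g 0).isLeft = b at *
    simp only [hleft]
    clear hleft
    have := ω_sq
    cases b <;> simp [Fin.sum_univ_succ, gonSign] <;> grind
  -- The sum is orthogonal to each root of the 12-gon: up to a unit, the inner product is `3 + θ *
  -- (ω - ω ^ 2) = 3 + θ * θ = 0`.
  · rw [herm_sum_right]
    refine Finset.sum_eq_zero fun k _ => ?_
    rw [herm_smul_right, herm_sum_left]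
    refine mul_eq_zero_of_right _ ?_
    -- This includes the wrap-around from 11 to 0, where it uses `(ω ^ 2) ^ 12 = 1`.
    have hpow (i : Fin 12) : (ω ^ 2) ^ (i + 1).val = (ω ^ 2) ^ i.val * ω ^ 2 := by
      have := ω_sq
      fin_cases i <;> simp <;> grind
    obtain ⟨i, rfl⟩ : ∃ i, i + 1 = k := ⟨k - 1, by simp⟩
    simp only [herm_smul_left, herm_gonRoot, mul_add, mul_ite, mul_zero, Finset.sum_add_distrib,
      Finset.sum_ite_eq', Finset.mem_univ, if_true, add_sub_cancel_right, hpow, θ_eq]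
    linear_combination ((ω ^ 2) ^ i.val * (-2 * ω ^ 3 + ω ^ 2 + ω + 1)) * ω_sq

theorem smul_mem_of_mem_eis {M : Submodule Eis V} {a : ℂ} (ha : a ∈ Eis) {x : V} (hx : x ∈ M) :
    a • x ∈ M :=
  M.smul_mem ⟨a, ha⟩ hx

theorem gonSign_mem (b : Bool) (i : Fin 12) : gonSign b i ∈ Eis := by
  rcases gonSign_eq b i with h | h <;> rw [h]
  · exact Eis.one_mem
  · exact Eis.neg_mem Eis.one_mem

theorem root_eq_smul_gonRoot (g : SimpleGraph.cycleGraph 12 ↪g incidenceGraph) (i : Fin 12) :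
    root (g i) = gonSign (g 0).isLeft i • gonRoot g i := by
  rw [gonRoot, smul_smul, gonSign_mul_self, one_smul]

/-- For a submodule `M` and a group `H`, the roots that belong to `M` and whose reflections belong to
`H` form a `12`-gon closed set. -/
theorem gonClosed_root_mem (M : Submodule Eis V) (H : Subgroup (V ≃ₗ[ℂ] V)) :
    GonClosed incidenceGraph {v | root v ∈ M ∧ reflection ωUnit (root v) ∈ H} := by
  intro g hg
  have hM (i : Fin 12) (hi : i ≠ 0) : gonRoot g i ∈ M :=
    smul_mem_of_mem_eis (gonSign_mem _ _) (hg i hi).1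
  have hH (i : Fin 12) (hi : i ≠ 0) : reflection ωUnit (gonRoot g i) ∈ H := by
    rw [gonRoot, reflection_smul _ (gonSign_ne_zero _ _)]
    exact (hg i hi).2
  have hrel : gonRoot g 0 + ω ^ 2 • ∑ i : Fin 11, (ω ^ 2) ^ i.val • gonRoot g i.succ = 0 := by
    have := sum_gonRoot g
    rw [Fin.sum_univ_succ] at this
    rw [Finset.smul_sum]
    simpa only [Fin.val_zero, pow_zero, one_smul, smul_smul, ← pow_succ', Fin.val_succ] using this
  constructor
  · rw [root_eq_smul_gonRoot]
    refine smul_mem_of_mem_eis (gonSign_mem _ _) ?_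
    rw [eq_neg_of_add_eq_zero_left hrel]
    exact M.neg_mem (smul_mem_of_mem_eis (pow_mem ω_mem 2) (M.sum_mem fun i _ =>
      smul_mem_of_mem_eis (pow_mem (pow_mem ω_mem 2) _) (hM _ (Fin.succ_ne_zero i))))
  -- The chain consists of the eleven roots with indices 1 to 11, shifted to start at 0; hence the
  -- bound 10.
  · have key := reflection_sum_mem H (fun n => gonRoot g (Fin.ofNat 12 (n + 1))) 10
      (fun i _ => herm_gonRoot_self g _) (fun i hi => herm_gonRoot_succ g _ _ ?_)
      (fun i j hij hj => ?_) (fun i hi => hH _ ?_)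
    · rw [Finset.sum_range] at key
      -- By the 12-gon relation the chain sum is a unit times the missing root, so both have the
      -- same reflection.
      have hsum : ∑ i : Fin 11, (ω ^ 2) ^ i.val • gonRoot g (Fin.ofNat 12 (i.val + 1)) =
          (-ω) • gonRoot g 0 := by
        have : ∀ i : Fin 11, Fin.ofNat 12 (i.val + 1) = i.succ := by decide
        simp only [this]
        rw [eq_neg_of_add_eq_zero_left hrel, smul_neg, neg_smul, neg_neg, smul_smul]
        rw [show ω * ω ^ 2 = 1 by linear_combination (ω - 1) * ω_sq, one_smul]
      rw [hsum, reflection_smul _ (neg_ne_zero.2 ω_ne_zero)] at key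
      rwa [root_eq_smul_gonRoot, reflection_smul _ (gonSign_ne_zero _ _)]
    · interval_cases i <;> decide
    · have hi : i ≤ 8 := by omega
      interval_cases i <;> interval_cases j <;>
        exact herm_gonRoot_eq_zero g (by decide) (by decide) (by decide)
    · interval_cases i <;> decide

/-- A single closure argument serves both the spanning statement and the generation of reflections.
-/
theorem root_mem_and_reflection_mem (f : diagram ↪g incidenceGraph) (v : Point ⊕ Line) :
    root v ∈ Submodule.span Eis (Set.range fun i => root (f i)) ∧
      reflection ωUnit (root v) ∈ R f := by
  have := (gonClosed_root_mem (Submodule.span Eis (Set.range fun i => root (f i))) (R f)).eq_univ f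
    fun i => ⟨Submodule.subset_span ⟨i, rfl⟩, Subgroup.subset_closure ⟨i, rfl⟩⟩
  exact (Set.eq_univ_iff_forall.1 this) v

/-! ### The line code -/

theorem lineWord_cyclicEquiv (i j : Fin 13) :
    lineWord (cyclicEquiv j) (cyclicEquiv i) = if cyclicInc i j then 1 else 0 := by
  classical
  simp only [lineWord, Set.indicator_apply, cyclicEquiv_mem_pointsOn, Pi.one_apply]

/-- Any two lines meet in `1` point modulo `3`. -/
theorem sum_lineWord_mul (l m : Line) : ∑ p, lineWord l p * lineWord m p = 1 := by
  obtain ⟨i, rfl⟩ := cyclicEquiv.surjective l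
  obtain ⟨j, rfl⟩ := cyclicEquiv.surjective m
  rw [← cyclicEquiv.sum_comp]
  simp only [lineWord_cyclicEquiv]
  revert i j
  decide +kernel

theorem lineWord_mem_lineCode (l : Line) : lineWord l ∈ lineCode := by
  intro c hc
  induction hc using Submodule.span_induction with
  | mem c hc =>
    obtain ⟨m, m', rfl⟩ := hc
    simp only [Pi.sub_apply, mul_sub, Finset.sum_sub_distrib, sum_lineWord_mul, sub_self]
  | zero => simp
  | add x y _ _ hx hy => simp only [Pi.add_apply, mul_add, Finset.sum_add_distrib, hx, hy, add_zero]
  | smul a x _ hx =>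
    simp only [Pi.smul_apply, smul_eq_mul, mul_left_comm _ a, ← Finset.mul_sum, hx, mul_zero]

/-- The incidence matrix of the cyclic model, modulo `3`. -/
def cyclicMatrix (i j : Fin 13) : ZMod 3 := if cyclicInc i j then 1 else 0

/-- The incidence matrix of the cyclic model with both labellings reversed, modulo `3`. -/
def cyclicMatrixNeg (i j : Fin 13) : ZMod 3 := if cyclicInc (-i) (-j) then 1 else 0

/-- The left side counts the ordered ways to write `i - k` or `k - i` as a sum of two elements of
the difference set. The total is 2 for `i = k`, and 1 or 4 otherwise. -/
theorem cyclicMatrix_mul_add (i k : Fin 13) :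
    ∑ j, cyclicMatrix i j * cyclicMatrixNeg j k + ∑ j, cyclicMatrixNeg i j * cyclicMatrix j k =
      (if i = k then 1 else 0) + 1 := by
  revert i k; decide +kernel

theorem sum_cyclicMatrix (i : Fin 13) : ∑ j, cyclicMatrix i j = 1 := by
  revert i; decide +kernel

theorem sum_cyclicMatrixNeg (i : Fin 13) : ∑ j, cyclicMatrixNeg i j = 1 := by
  revert i; decide +kernel

/-- A word that has the same inner product with all lines is a combination of lines. -/
theorem exists_eq_sum_cyclicMatrix (w : Fin 13 → ZMod 3) (k : ZMod 3)
    (hw : ∀ i, ∑ j, cyclicMatrix i j * w j = k) :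
    ∃ a : Fin 13 → ZMod 3, ∀ i, w i = ∑ j, cyclicMatrix i j * a j := by
  -- With `N`, `N'` the two matrices, `N N' w + N' N w = w + (∑ w) 1`. Since `N w = k 1` and the
  -- rows of `N` and `N'` sum to 1, this reads `w = N (N' w + (k - ∑ w) 1)`.
  refine ⟨fun j => ∑ m, cyclicMatrixNeg j m * w m + (k - ∑ m, w m), fun i => ?_⟩
  have h := Finset.sum_congr (s₁ := Finset.univ) rfl fun m _ =>
    congrArg (· * w m) (cyclicMatrix_mul_add i m)
  simp only [add_mul, Finset.sum_add_distrib, ite_mul, one_mul, zero_mul, Finset.sum_ite_eq,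
    Finset.mem_univ, if_true, Finset.sum_mul] at h
  rw [Finset.sum_comm, Finset.sum_comm (f := fun m j => cyclicMatrixNeg i j * _ * _)] at h
  simp only [mul_assoc, ← Finset.mul_sum, hw] at h
  rw [← Finset.sum_mul, sum_cyclicMatrixNeg] at h
  simp only [mul_add, Finset.sum_add_distrib, ← Finset.sum_mul, sum_cyclicMatrix]
  linear_combination -h

/-- The line code is spanned by the lines. -/
theorem exists_eq_sum_lineWord {c : Point → ZMod 3} (hc : c ∈ lineCode) :
    ∃ a : Line → ZMod 3, ∀ p, c p = ∑ l, a l * lineWord l p := by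
  have hN (i j : Fin 13) : lineWord (cyclicEquiv j) (cyclicEquiv i) = cyclicMatrix i j :=
    lineWord_cyclicEquiv i j
  have hsymm : ∀ i j, cyclicMatrix i j = cyclicMatrix j i := by decide +kernel
  obtain ⟨a, ha⟩ := exists_eq_sum_cyclicMatrix (fun i => c (cyclicEquiv i))
    (∑ p, c p * lineWord (cyclicEquiv 0) p) fun i => by
      have := hc _ (Submodule.subset_span ⟨cyclicEquiv i, cyclicEquiv 0, rfl⟩)
      simp only [Pi.sub_apply, mul_sub, Finset.sum_sub_distrib, sub_eq_zero] at this
      rw [← this, ← cyclicEquiv.sum_comp]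
      simp only [hN, hsymm i, mul_comm]
  refine ⟨fun l => a (cyclicEquiv.symm l), fun p => ?_⟩
  obtain ⟨i, rfl⟩ := cyclicEquiv.surjective p
  rw [ha, ← cyclicEquiv.sum_comp]
  simp only [hN, cyclicEquiv.symm_apply_apply, mul_comm]

/-! ### The roots span the lattice -/

theorem CongrTheta.refl (x : ℂ) : CongrTheta x x := ⟨0, Eis.zero_mem, by ring⟩

theorem pointRoot_mem (p : Point) : pointRoot p ∈ L := by
  classical
  refine ⟨Eis.zero_mem, fun q => ?_, ⟨-1, Eis.neg_mem Eis.one_mem, ?_⟩, 0, lineCode.zero_mem,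
    fun q => ?_⟩
  · rw [pointRoot_snd_apply]
    split_ifs
    exacts [θ_mem, Eis.zero_mem]
  · simp [pointRoot]
  · rw [pointRoot_snd_apply]
    split_ifs
    · exact ⟨1, Eis.one_mem, by simp⟩
    · exact ⟨0, Eis.zero_mem, by simp⟩

theorem sum_lineRoot_snd (l : Line) : ∑ p, (lineRoot l).2 p = 4 := by
  classical
  obtain ⟨j, rfl⟩ := cyclicEquiv.surjective l
  have := congrArg (Nat.cast (R := ℂ)) (sum_cyclicInc_mul j j)
  rw [← cyclicEquiv.sum_comp]
  simpa [lineRoot_snd_apply, cyclicEquiv_mem_pointsOn] using this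

theorem lineRoot_mem (l : Line) : lineRoot l ∈ L := by
  classical
  refine ⟨Eis.one_mem, fun q => ?_, ?_, lineWord l, lineWord_mem_lineCode l, fun q => ?_⟩
  · rw [lineRoot_snd_apply]
    split_ifs
    exacts [Eis.one_mem, Eis.zero_mem]
  · rw [sum_lineRoot_snd]
    have := congrTheta_intCast (m := 1) (n := 4) (by decide)
    exact_mod_cast this
  · rw [lineRoot_snd_apply, lineWord, Set.indicator_apply]
    split_ifs
    · simpa [ZMod.val_one] using CongrTheta.refl 1
    · simpa using CongrTheta.refl 0

theorem root_mem (v : Point ⊕ Line) : root v ∈ L := by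
  rcases v with p | l
  exacts [pointRoot_mem p, lineRoot_mem l]

/-- A vector with all coordinates divisible by `θ` is a combination of roots. -/
theorem mem_of_forall_congrTheta_zero {M : Submodule Eis V} (hM : ∀ v, root v ∈ M) {x : V}
    (h₁ : CongrTheta x.1 0) (h₂ : ∀ p, CongrTheta (x.2 p) 0) : x ∈ M := by
  classical
  have sum_point (s : Finset Point) (e : Point → ℂ) :
      ∑ p ∈ s, e p • pointRoot p = (0, fun q => if q ∈ s then θ * e q else 0) := by
    ext q
    · simp [Prod.fst_sum, pointRoot]
    · simp [Prod.snd_sum, Finset.sum_apply, pointRoot_snd_apply, mul_comm]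
  have h0 : ((θ, 0) : V) ∈ M := by
    let l : Line := cyclicEquiv 0
    -- Multiplying a line root by `θ` and removing the point roots on that line leaves only the
    -- first coordinate.
    have : ((θ, 0) : V) = θ • root (.inr l) -
        ∑ p ∈ Finset.univ.filter (· ∈ pointsOn l), (1 : ℂ) • root (.inl p) := by
      simp only [root, Sum.elim_inl, Sum.elim_inr, sum_point]
      ext q
      · simp [lineRoot]
      · simp [lineRoot_snd_apply]
    rw [this]
    exact M.sub_mem (smul_mem_of_mem_eis θ_mem (hM _))
      (M.sum_mem fun p _ => smul_mem_of_mem_eis Eis.one_mem (hM _))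
  obtain ⟨e, he, h₁⟩ := h₁
  choose e' he' h₂ using h₂
  have : x = e • (θ, 0) + ∑ p, e' p • root (.inl p) := by
    simp only [root, Sum.elim_inl, sum_point]
    ext q
    · simpa [mul_comm] using h₁
    · simpa using h₂ q
  rw [this]
  exact M.add_mem (smul_mem_of_mem_eis he h0)
    (M.sum_mem fun p _ => smul_mem_of_mem_eis (he' p) (hM _))

/-- A submodule that contains the `26` roots contains `L`. -/
theorem le_of_forall_root_mem {M : Submodule Eis V} (hM : ∀ v, root v ∈ M) : L ≤ M := by
  classical
  intro x hx
  obtain ⟨c, hc, hxc⟩ := hx.2.2.2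
  obtain ⟨a, ha⟩ := exists_eq_sum_lineWord hc
  have natCast_mem_eis (n : ℕ) : (n : ℂ) ∈ Eis := natCast_mem Eis n
  -- The combination `y` of line roots lifts the word `c`, so the last 13 coordinates of `x - y` are
  -- divisible by `θ`.
  set y : V := ∑ l, ((a l).val : ℂ) • lineRoot l with hy
  have hyM : y ∈ M := M.sum_mem fun l _ => smul_mem_of_mem_eis (natCast_mem_eis _) (hM (.inr l))
  have hyL : y ∈ L := L.sum_mem fun l _ => smul_mem_of_mem_eis (natCast_mem_eis _) (lineRoot_mem l)
  have hp (p : Point) : CongrTheta ((x - y).2 p) 0 := by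
    have h₁ : y.2 p = ((∑ l, (a l).val * (lineWord l p).val : ℕ) : ℂ) := by
      rw [hy]
      simp only [Prod.snd_sum, Finset.sum_apply, Prod.smul_snd, Pi.smul_apply, smul_eq_mul,
        lineRoot_snd_apply, lineWord, Set.indicator_apply]
      push_cast
      refine Finset.sum_congr rfl fun l _ => ?_
      split_ifs <;> simp [ZMod.val_one]
    have h₂ := congrTheta_intCast (m := ((c p).val : ℕ))
      (n := ((∑ l, (a l).val * (lineWord l p).val : ℕ))) (by simp [ha p])
    obtain ⟨e, he, h⟩ := (hxc p).trans (by exact_mod_cast h₂)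
    refine ⟨e, he, ?_⟩
    rw [Prod.snd_sub, Pi.sub_apply, h₁, ← h, sub_zero]
  -- In `L` the first coordinate is congruent to the sum of the others, so it is divisible by `θ`
  -- too.
  have h0 : CongrTheta (x - y).1 0 := by
    refine (L.sub_mem hx hyL).2.2.1.trans ?_
    choose e he h using hp
    refine ⟨∑ p, e p, Eis.sum_mem fun p _ => he p, ?_⟩
    simp only [sub_zero] at h
    rw [Finset.mul_sum, sub_zero]
    exact Finset.sum_congr rfl fun p _ => h p
  rw [← sub_add_cancel x y]
  exact M.add_mem (mem_of_forall_congrTheta_zero hM h0 hp) hyM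

theorem span_root_eq (f : diagram ↪g incidenceGraph) :
    Submodule.span Eis (Set.range fun i => root (f i)) = L := by
  refine le_antisymm (Submodule.span_le.2 ?_)
    (le_of_forall_root_mem fun v => (root_mem_and_reflection_mem f v).1)
  rintro _ ⟨i, rfl⟩
  exact root_mem _

/-! ### Triflections in all 26 roots -/

/-- The units of order `3` are `ω` and its inverse. -/
theorem eq_ωUnit_or_inv {ζ : ℂˣ} (hζ : orderOf ζ = 3) : ζ = ωUnit ∨ ζ = ωUnit⁻¹ := by
  have h3 : (ζ : ℂ) ^ 3 = 1 := by
    rw [← Units.val_pow_eq_pow_val, ← hζ, pow_orderOf_eq_one, Units.val_one]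
  have h1 : (ζ : ℂ) - 1 ≠ 0 := by
    intro h
    have : ζ = 1 := Units.ext (sub_eq_zero.1 h)
    simp [this] at hζ
  have h : ((ζ : ℂ) - ω) * (ζ + 1 + ω) = 0 := by
    apply mul_left_cancel₀ h1
    linear_combination h3 - ((ζ : ℂ) - 1) * ω_sq
  rcases mul_eq_zero.1 h with h | h
  · exact .inl (Units.ext (sub_eq_zero.1 h))
  · right
    apply eq_inv_of_mul_eq_one_left
    apply Units.ext
    rw [Units.val_mul, ωUnit_val, Units.val_one]
    linear_combination ω * h - ω_sq

theorem reflection_mem (f : diagram ↪g incidenceGraph) (v : Point ⊕ Line) {ζ : ℂˣ}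
    (hζ : orderOf ζ = 3) : reflection ζ (root v) ∈ R f := by
  have h := (root_mem_and_reflection_mem f v).2
  rcases eq_ωUnit_or_inv hζ with rfl | rfl
  · exact h
  · rw [← reflection_inv]
    exact (R f).inv_mem h

/-! ### The Garside element of a chain of five roots -/

/-- The Garside element of the braid group of a chain of five roots. -/
def garside (r₁ r₂ r₃ r₄ r₅ : V) : V ≃ₗ[ℂ] V :=
  let s := reflection ωUnit
  s r₁ * (s r₂ * s r₁) * (s r₃ * s r₂ * s r₁) * (s r₄ * s r₃ * s r₂ * s r₁) *
    (s r₅ * s r₄ * s r₃ * s r₂ * s r₁)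

/-- Five roots, alternately line and point roots, that form a chain. -/
structure IsChain (r₁ r₂ r₃ r₄ r₅ : V) : Prop where
  h₁₁ : herm r₁ r₁ = 3
  h₂₂ : herm r₂ r₂ = 3
  h₃₃ : herm r₃ r₃ = 3
  h₄₄ : herm r₄ r₄ = 3
  h₅₅ : herm r₅ r₅ = 3
  h₂₁ : herm r₂ r₁ = θ
  h₂₃ : herm r₂ r₃ = θ
  h₄₃ : herm r₄ r₃ = θ
  h₄₅ : herm r₄ r₅ = θ
  h₁₃ : herm r₁ r₃ = 0
  h₁₄ : herm r₁ r₄ = 0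
  h₁₅ : herm r₁ r₅ = 0
  h₂₄ : herm r₂ r₄ = 0
  h₂₅ : herm r₂ r₅ = 0
  h₃₅ : herm r₃ r₅ = 0

theorem herm_eq_neg_θ {x y : V} (h : herm x y = θ) : herm y x = -θ := by
  rw [herm_symm, h, conj_θ]

theorem herm_eq_zero_symm {x y : V} (h : herm x y = 0) : herm y x = 0 := by
  rw [herm_symm, h, map_zero]

/-- The Garside element of a chain of roots, as a linear map. -/
theorem IsChain.garside_apply {r₁ r₂ r₃ r₄ r₅ : V} (h : IsChain r₁ r₂ r₃ r₄ r₅) (x : V) :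
    garside r₁ r₂ r₃ r₄ r₅ x = x + (1 / 3 : ℂ) •
      (((ω - 1) * herm x r₁ + (ω + 2) * herm x r₂ + (2 * ω + 1) * herm x r₃ +
          (1 - ω) * herm x r₄ + (ω + 2) * herm x r₅) • r₁ +
        ((-ω - 2) * herm x r₁ + 3 * ω * herm x r₂ - 3 * herm x r₃ + (3 * ω + 3) * herm x r₄ +
          (ω - 1) * herm x r₅) • r₂ +
        ((2 * ω + 1) * herm x r₁ + 3 * herm x r₂ + (4 * ω + 2) * herm x r₃ + 3 * herm x r₄ +
          (2 * ω + 1) * herm x r₅) • r₃ +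
        ((ω - 1) * herm x r₁ + (3 * ω + 3) * herm x r₂ - 3 * herm x r₃ + 3 * ω * herm x r₄ +
          (-ω - 2) * herm x r₅) • r₄ +
        ((ω + 2) * herm x r₁ + (1 - ω) * herm x r₂ + (2 * ω + 1) * herm x r₃ +
          (ω + 2) * herm x r₄ + (ω - 1) * herm x r₅) • r₅) := by
  obtain ⟨h₁₁, h₂₂, h₃₃, h₄₄, h₅₅, h₂₁, h₂₃, h₄₃, h₄₅, h₁₃, h₁₄, h₁₅, h₂₄, h₂₅, h₃₅⟩ := h
  have h₁₂ := herm_eq_neg_θ h₂₁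
  have h₃₂ := herm_eq_neg_θ h₂₃
  have h₃₄ := herm_eq_neg_θ h₄₃
  have h₅₄ := herm_eq_neg_θ h₄₅
  have h₃₁ := herm_eq_zero_symm h₁₃
  have h₄₁ := herm_eq_zero_symm h₁₄
  have h₅₁ := herm_eq_zero_symm h₁₅
  have h₄₂ := herm_eq_zero_symm h₂₄
  have h₅₂ := herm_eq_zero_symm h₂₅
  have h₅₃ := herm_eq_zero_symm h₃₅
  -- Each reflection changes only one of the five coefficients, so the product of fifteen
  -- reflections becomes a substitution in them. A neighbor enters with factor `(ω - 1) * (±θ) / 3 =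
  -- ∓(1 + ω)`.
  let C (c₁ c₂ c₃ c₄ c₅ : ℂ) : V :=
    x + (1 / 3 : ℂ) • (c₁ • r₁ + c₂ • r₂ + c₃ • r₃ + c₄ • r₄ + c₅ • r₅)
  have step {r : V} (hr : herm r r = 3) (d c₁ c₂ c₃ c₄ c₅ : ℂ)
      (hd : d = (ω - 1) * herm (C c₁ c₂ c₃ c₄ c₅) r) :
      reflection ωUnit r (C c₁ c₂ c₃ c₄ c₅) = C c₁ c₂ c₃ c₄ c₅ + (1 / 3 : ℂ) • d • r := by
    rw [reflection_apply, hr, hd, ωUnit_val, smul_smul]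
    congr 2
    ring
  have hω := ω_sq
  have s₁ (c₁ c₂ c₃ c₄ c₅ : ℂ) : reflection ωUnit r₁ (C c₁ c₂ c₃ c₄ c₅) =
      C (ω * c₁ + (ω - 1) * herm x r₁ - (1 + ω) * c₂) c₂ c₃ c₄ c₅ := by
    rw [step h₁₁ ((ω - 1) * herm x r₁ + (ω - 1) * c₁ - (1 + ω) * c₂)]
    · simp only [C]
      module
    · simp only [C, herm_add_left, herm_smul_left, h₁₁, h₂₁, h₃₁, h₄₁, h₅₁, θ_eq]
      grind
  have s₂ (c₁ c₂ c₃ c₄ c₅ : ℂ) : reflection ωUnit r₂ (C c₁ c₂ c₃ c₄ c₅) =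
      C c₁ (ω * c₂ + (ω - 1) * herm x r₂ + (1 + ω) * (c₁ + c₃)) c₃ c₄ c₅ := by
    rw [step h₂₂ ((ω - 1) * herm x r₂ + (ω - 1) * c₂ + (1 + ω) * (c₁ + c₃))]
    · simp only [C]
      module
    · simp only [C, herm_add_left, herm_smul_left, h₁₂, h₂₂, h₃₂, h₄₂, h₅₂, θ_eq]
      grind
  have s₃ (c₁ c₂ c₃ c₄ c₅ : ℂ) : reflection ωUnit r₃ (C c₁ c₂ c₃ c₄ c₅) =
      C c₁ c₂ (ω * c₃ + (ω - 1) * herm x r₃ - (1 + ω) * (c₂ + c₄)) c₄ c₅ := by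
    rw [step h₃₃ ((ω - 1) * herm x r₃ + (ω - 1) * c₃ - (1 + ω) * (c₂ + c₄))]
    · simp only [C]
      module
    · simp only [C, herm_add_left, herm_smul_left, h₁₃, h₂₃, h₃₃, h₄₃, h₅₃, θ_eq]
      grind
  have s₄ (c₁ c₂ c₃ c₄ c₅ : ℂ) : reflection ωUnit r₄ (C c₁ c₂ c₃ c₄ c₅) =
      C c₁ c₂ c₃ (ω * c₄ + (ω - 1) * herm x r₄ + (1 + ω) * (c₃ + c₅)) c₅ := by
    rw [step h₄₄ ((ω - 1) * herm x r₄ + (ω - 1) * c₄ + (1 + ω) * (c₃ + c₅))]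
    · simp only [C]
      module
    · simp only [C, herm_add_left, herm_smul_left, h₁₄, h₂₄, h₃₄, h₄₄, h₅₄, θ_eq]
      grind
  have s₅ (c₁ c₂ c₃ c₄ c₅ : ℂ) : reflection ωUnit r₅ (C c₁ c₂ c₃ c₄ c₅) =
      C c₁ c₂ c₃ c₄ (ω * c₅ + (ω - 1) * herm x r₅ - (1 + ω) * c₄) := by
    rw [step h₅₅ ((ω - 1) * herm x r₅ + (ω - 1) * c₅ - (1 + ω) * c₄)]
    · simp only [C]
      module
    · simp only [C, herm_add_left, herm_smul_left, h₁₅, h₂₅, h₃₅, h₄₅, h₅₅, θ_eq]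
      grind
  have hx : x = C 0 0 0 0 0 := by simp [C]
  conv_lhs => rw [hx]
  simp only [garside, LinearEquiv.mul_apply, s₁, s₂, s₃, s₄, s₅]
  change C _ _ _ _ _ = C _ _ _ _ _
  clear_value C
  generalize herm x r₁ = a₁
  generalize herm x r₂ = a₂
  generalize herm x r₃ = a₃
  generalize herm x r₄ = a₄
  generalize herm x r₅ = a₅
  clear step s₁ s₂ s₃ s₄ s₅ hx
  refine congr (congr (congr (congr (congrArg C ?_) ?_) ?_) ?_) ?_
  all_goals grind

theorem garside_mem {H : Subgroup (V ≃ₗ[ℂ] V)} (hH : ∀ v, reflection ωUnit (root v) ∈ H)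
    (v₁ v₂ v₃ v₄ v₅ : Point ⊕ Line) :
    garside (root v₁) (root v₂) (root v₃) (root v₄) (root v₅) ∈ H := by
  have h₁ := hH v₁
  have h₂ := hH v₂
  have h₃ := hH v₃
  have h₄ := hH v₄
  have h₅ := hH v₅
  exact mul_mem (mul_mem (mul_mem (mul_mem h₁ (mul_mem h₂ h₁)) (mul_mem (mul_mem h₃ h₂) h₁))
    (mul_mem (mul_mem (mul_mem h₄ h₃) h₂) h₁))
    (mul_mem (mul_mem (mul_mem (mul_mem h₅ h₄) h₃) h₂) h₁)

/-! ### The action of `L₃(3)` on the roots -/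

theorem permAction_apply (g : PSL(3, ZMod 3)) (x : V) :
    permAction g x = (x.1, fun p => x.2 (g⁻¹ • p)) := rfl

theorem herm_permAction (g : PSL(3, ZMod 3)) (x y : V) :
    herm (permAction g x) (permAction g y) = herm x y := by
  simp only [herm, permAction_apply]
  congr 1
  exact Equiv.sum_comp (MulAction.toPerm g⁻¹) fun p => x.2 p * conj (y.2 p)

theorem permAction_pointRoot (g : PSL(3, ZMod 3)) (p : Point) :
    permAction g (pointRoot p) = pointRoot (g • p) := by
  classical
  refine Prod.ext rfl (funext fun q => ?_)
  simp only [permAction_apply, pointRoot_snd_apply, inv_smul_eq_iff]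

theorem permAction_lineRoot (g : SL(3, ZMod 3)) (l : Line) :
    permAction g (lineRoot l) = lineRoot (contragredient (g : GL (Fin 3) (ZMod 3)) • l) := by
  classical
  refine Prod.ext rfl (funext fun q => ?_)
  obtain ⟨p, rfl⟩ := (MulAction.toPerm (g : PSL(3, ZMod 3))).surjective q
  simp only [permAction_apply, lineRoot_snd_apply, MulAction.toPerm_apply, inv_smul_smul]
  congr 1
  exact propext (smul_mem_pointsOn_smul (g : GL (Fin 3) (ZMod 3)) p l).symm

theorem exists_permAction_root (g : PSL(3, ZMod 3)) (v : Point ⊕ Line) :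
    ∃ w, permAction g (root v) = root w := by
  obtain ⟨g, rfl⟩ := QuotientGroup.mk_surjective g
  rcases v with p | l
  · exact ⟨.inl _, permAction_pointRoot _ p⟩
  · exact ⟨.inr _, permAction_lineRoot g l⟩

/-- The permutations of coordinates normalize the group `R`. -/
theorem permAction_conj_mem (f : diagram ↪g incidenceGraph) (g : PSL(3, ZMod 3))
    {x : V ≃ₗ[ℂ] V} (hx : x ∈ R f) : permAction g * x * (permAction g)⁻¹ ∈ R f := by
  suffices R f ≤ (R f).comap (MulAut.conj (permAction g)).toMonoidHom from this hx
  refine (Subgroup.closure_le _).2 ?_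
  rintro _ ⟨i, rfl⟩
  obtain ⟨w, hw⟩ := exists_permAction_root g (f i)
  change permAction g * reflection ωUnit (root (f i)) * (permAction g)⁻¹ ∈ R f
  rw [mul_reflection_mul_inv _ (herm_permAction g), hw]
  exact (root_mem_and_reflection_mem f w).2

/-! ### A homology as a product of Garside elements -/

theorem isChain_root (a b c d e : Fin 13)
    (h : (cyclicInc b a ∧ cyclicInc b c ∧ cyclicInc d c ∧ cyclicInc d e) ∧ ¬ cyclicInc d a ∧
      ¬ cyclicInc b e ∧ a ≠ c ∧ a ≠ e ∧ c ≠ e ∧ b ≠ d) :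
    IsChain (root (.inr (cyclicEquiv a))) (root (.inl (cyclicEquiv b)))
      (root (.inr (cyclicEquiv c))) (root (.inl (cyclicEquiv d)))
      (root (.inr (cyclicEquiv e))) := by
  classical
  obtain ⟨⟨h₁, h₂, h₃, h₄⟩, h₅, h₆, h₇, h₈, h₉, h₁₀⟩ := h
  constructor <;>
    simp [herm_root_root, cyclicEquiv_mem_pointsOn, *]

theorem herm_root_inl (x : V) (i : Fin 13) :
    herm x (root (.inl (cyclicEquiv i))) = -(1 + 2 * ω) * x.2 (cyclicEquiv i) := by
  rw [← θ_eq]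
  exact herm_pointRoot_right x _

theorem herm_root_inr (x : V) (j : Fin 13) :
    herm x (root (.inr (cyclicEquiv j))) = -x.1 + (x.2 (cyclicEquiv (0 - j)) +
      x.2 (cyclicEquiv (1 - j)) + x.2 (cyclicEquiv (3 - j)) + x.2 (cyclicEquiv (9 - j))) := by
  classical
  refine (herm_lineRoot_right x _).trans ?_
  rw [← cyclicEquiv.sum_comp]
  simp only [Set.indicator_apply, cyclicEquiv_mem_pointsOn]
  have : (Finset.univ.filter fun i => cyclicInc i j = true) = {0 - j, 1 - j, 3 - j, 9 - j} := by
    revert j; decide +kernel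
  rw [← Finset.sum_filter, this, Finset.sum_insert, Finset.sum_insert, Finset.sum_insert,
    Finset.sum_singleton]
  · ring
  all_goals revert j; decide +kernel

/-- The homology `diag(1, -1, -1)`. -/
def homology : SL(3, ZMod 3) := ⟨diagonal ![1, -1, -1], by simp [det_diagonal, Fin.prod_univ_three]⟩

/-- The homology `diag(1, -1, -1)` in the cyclic model. -/
def cyclicHomology : Fin 13 → Fin 13 := ![7, 2, 1, 6, 4, 5, 3, 0, 11, 9, 10, 8, 12]

theorem homology_smul (i : Fin 13) :
    (homology : PSL(3, ZMod 3))⁻¹ • cyclicEquiv i = cyclicEquiv (cyclicHomology i) := by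
  rw [inv_smul_eq_iff]
  symm
  refine (Projectivization.mk_eq_mk_iff' (ZMod 3) _ _ _ _).2 ?_
  have : ∀ i, ∃ a : ZMod 3, a • cyclicVec i =
      diagonal ![1, -1, -1] *ᵥ cyclicVec (cyclicHomology i) := by
    decide +kernel
  exact this i

theorem root_inr_snd (i j : Fin 13) :
    (root (.inr (cyclicEquiv j))).2 (cyclicEquiv i) = if cyclicInc i j then 1 else 0 := by
  classical
  simp [root, lineRoot_snd_apply, cyclicEquiv_mem_pointsOn]

theorem root_inl_snd (i j : Fin 13) :
    (root (.inl (cyclicEquiv j))).2 (cyclicEquiv i) = if i = j then 1 + 2 * ω else 0 := by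
  classical
  simp [root, pointRoot_snd_apply, θ_eq]

theorem root_inr_fst (j : Fin 13) : (root (.inr (cyclicEquiv j))).1 = 1 := rfl

theorem root_inl_fst (j : Fin 13) : (root (.inl (cyclicEquiv j))).1 = 0 := rfl

/-- The Garside element of the chain with the given labels. -/
def cyclicGarside (a b c d e : Fin 13) : V ≃ₗ[ℂ] V :=
  garside (root (.inr (cyclicEquiv a))) (root (.inl (cyclicEquiv b)))
    (root (.inr (cyclicEquiv c))) (root (.inl (cyclicEquiv d))) (root (.inr (cyclicEquiv e)))

/-- The homology reverses both chains: it swaps the labels 1, 2 and the labels 3, 6, and fixes 12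
and 10, for points and lines alike. The two Garside elements differ exactly by it, as a check of all
14 coordinates shows. Hence the homology is a quotient of elements of `R`. -/
theorem cyclicGarside_eq_mul :
    cyclicGarside 1 2 12 1 2 = permAction homology * cyclicGarside 3 6 10 3 6 := by
  ext1 x
  rw [LinearEquiv.mul_apply, cyclicGarside, cyclicGarside,
    (isChain_root 1 2 12 1 2 (by decide)).garside_apply,
    (isChain_root 3 6 10 3 6 (by decide)).garside_apply, permAction_apply]
  obtain ⟨t, y⟩ := x
  -- In labelled coordinates, the claim becomes 14 identities that are linear in the entries of `x`,
  -- with coefficients reduced by `ω_sq`.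
  obtain ⟨y, rfl⟩ : ∃ z : Fin 13 → ℂ, z ∘ cyclicEquiv.symm = y := ⟨y ∘ cyclicEquiv, by ext; simp⟩
  have := ω_sq
  refine Prod.ext ?_ (funext fun p => ?_)
  · simp only [herm_root_inl, herm_root_inr, Prod.fst_add, Prod.smul_fst, root_inr_fst,
      root_inl_fst, smul_eq_mul, Function.comp_apply, cyclicEquiv.symm_apply_apply]
    simp only [Fin.reduceSub, Fin.isValue]
    grind
  · obtain ⟨i, rfl⟩ := cyclicEquiv.surjective p
    simp only [herm_root_inl, herm_root_inr, homology_smul, Prod.snd_add, Prod.smul_snd,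
      Pi.add_apply, Pi.smul_apply, root_inr_snd, root_inl_snd, smul_eq_mul, Function.comp_apply,
      cyclicEquiv.symm_apply_apply]
    simp only [Fin.reduceSub, Fin.isValue]
    fin_cases i
    all_goals simp [cyclicHomology, cyclicInc]
    all_goals grind

/-! ### Generating `L₃(3)` by homologies -/

/-- The cyclic permutation matrix. -/
def cyclicPerm : SL(3, ZMod 3) := ⟨!![0, 0, 1; 1, 0, 0; 0, 1, 0], by simp [det_fin_three]⟩

theorem diag2n_neg_one_coe {i j : Fin 3} (hij : i ≠ j) (h : (-1 : ZMod 3) ≠ 0) :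
    (diag2n hij (-1) h : Matrix (Fin 3) (Fin 3) (ZMod 3)) =
      diagonal fun m => if m = i then -1 else if m = j then -1 else 1 := by
  rw [diag2n_coe, inv_neg, inv_one]

/-- The only possible `c` is `-1`, so the matrix has `-1` at the places `i` and `j`. The cyclic
permutation matrix permutes the three such matrices transitively by conjugation. -/
theorem diag2n_eq_conj_homology {i j : Fin 3} (hij : i ≠ j) {c : ZMod 3} (hc : c ≠ 0)
    (hc' : c ≠ 1) : ∃ n : ℕ, diag2n hij c hc = cyclicPerm ^ n * homology * (cyclicPerm ^ n)⁻¹ := by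
  have key : ∀ i j : Fin 3, i ≠ j → ∃ n : Fin 3,
      (diagonal fun m => if m = i then -1 else if m = j then -1 else 1) *
        (!![0, 0, 1; 1, 0, 0; 0, 1, 0] : Matrix (Fin 3) (Fin 3) (ZMod 3)) ^ n.val =
      (!![0, 0, 1; 1, 0, 0; 0, 1, 0] : Matrix (Fin 3) (Fin 3) (ZMod 3)) ^ n.val *
        diagonal ![1, -1, -1] := by
    decide +kernel
  obtain ⟨n, hn⟩ := key i j hij
  refine ⟨n, ?_⟩
  rw [eq_mul_inv_iff_mul_eq]
  apply Subtype.ext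
  obtain rfl : c = -1 := by
    revert c
    decide
  rwa [coe_mul, coe_mul, coe_pow, diag2n_neg_one_coe]

/-- The diagonal matrix changes the sign of coordinate `i` but not of `j`, so conjugation by it
negates the parameter of the transvection. -/
theorem diag2n_mul_transvection {i j k : Fin 3} (hij : i ≠ j) (hik : i ≠ k) (hjk : j ≠ k)
    (a : ZMod 3) : diag2n hik (-1 : ZMod 3) (by decide) * transvection hij a =
      transvection hij (-a) * diag2n hik (-1 : ZMod 3) (by decide) := by
  have key : ∀ (i j k : Fin 3) (a : ZMod 3), i ≠ j → i ≠ k → j ≠ k →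
      (diagonal fun m => if m = i then -1 else if m = k then -1 else 1) * (1 + single i j a) =
      (1 + single i j (-a)) * diagonal fun m => if m = i then -1 else if m = k then -1 else 1 := by
    decide +kernel
  apply Subtype.ext
  rw [coe_mul, coe_mul, diag2n_neg_one_coe, transvection_coe, transvection_coe]
  exact key i j k a hij hik hjk

/-- A normal subgroup of `SL₃(𝔽₃)` that contains a homology is everything. -/
theorem eq_top_of_homology_mem (N : Subgroup SL(3, ZMod 3)) [N.Normal] (h : homology ∈ N) :
    N = ⊤ := by
  have hdiag {i j : Fin 3} (hij : i ≠ j) {c : ZMod 3} (hc : c ≠ 0) : diag2n hij c hc ∈ N := by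
    by_cases hc' : c = 1
    · subst hc'
      convert N.one_mem
      apply Subtype.ext
      simp [diag2n_coe]
    · obtain ⟨n, hn⟩ := diag2n_eq_conj_homology hij hc hc'
      rw [hn]
      exact Subgroup.Normal.conj_mem inferInstance _ h _
  refine (Subgroup.eq_top_iff' N).2 fun g => ?_
  refine diagonal_transvection_induction' (· ∈ N) g (fun i j hij c hc => hdiag hij hc)
    (fun i j hij a => ?_) fun _ _ => N.mul_mem
  obtain ⟨k, hik, hjk⟩ : ∃ k : Fin 3, i ≠ k ∧ j ≠ k := by revert i j; decide
  have hd := hdiag hik (c := -1) (by decide)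
  -- The commutator of the homology with the transvection of parameter `a` has parameter `-2 * a`,
  -- which equals `a` in characteristic 3.
  have : transvection hij a = diag2n hik (-1 : ZMod 3) (by decide) *
      (transvection hij a * (diag2n hik (-1 : ZMod 3) (by decide))⁻¹ * (transvection hij a)⁻¹) := by
    rw [← mul_assoc, ← mul_assoc, diag2n_mul_transvection hij hik hjk, mul_inv_cancel_right,
      transvection_inv, ← transvection_add]
    congr 1
    revert a
    decide
  rw [this]
  exact N.mul_mem hd (Subgroup.Normal.conj_mem inferInstance _ (N.inv_mem hd) _)

/-- The preimage of `R` in `SL(3, ZMod 3)` is normal because coordinate permutations normalize `R`,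
and it contains the homology. -/
theorem L33_le (f : diagram ↪g incidenceGraph) : L33 ≤ R f := by
  let N : Subgroup SL(3, ZMod 3) :=
    (R f).comap (permAction.comp (QuotientGroup.mk' (Subgroup.center SL(3, ZMod 3))))
  have hN (g : SL(3, ZMod 3)) : g ∈ N ↔ permAction (g : PSL(3, ZMod 3)) ∈ R f := Iff.rfl
  have : N.Normal := ⟨fun n hn g => by
    rw [hN] at hn ⊢
    have := permAction_conj_mem f (g : PSL(3, ZMod 3)) hn
    rwa [← map_inv, ← map_mul, ← map_mul] at this⟩
  have hH (v : Point ⊕ Line) := (root_mem_and_reflection_mem f v).2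
  have hhom : homology ∈ N := by
    rw [hN, eq_mul_inv_of_mul_eq cyclicGarside_eq_mul.symm]
    exact (R f).mul_mem (garside_mem hH _ _ _ _ _) ((R f).inv_mem (garside_mem hH _ _ _ _ _))
  rintro _ ⟨g, rfl⟩
  obtain ⟨g, rfl⟩ := QuotientGroup.mk_surjective g
  rw [← hN, eq_top_of_homology_mem N hhom]
  exact Subgroup.mem_top g

end Y555

end

/-- The `Y₅₅₅` diagram embeds (as an induced subgraph) in the incidence graph `Δ` of `P²(𝔽₃)`, and for
every such embedding the 16 corresponding point and line roots span `L` over `ℤ[ω]`, and the group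
`R` generated by their `ω`-reflections contains both triflections in each of the 26 point and line
roots and contains `L₃(3)`. -/
theorem lemma6 :
    Nonempty (Y555.diagram ↪g Y555.incidenceGraph) ∧
    ∀ f : Y555.diagram ↪g Y555.incidenceGraph,
      Submodule.span Y555.Eis (Set.range fun i => Y555.root (f i)) = Y555.L ∧
      (∀ (v : Y555.Point ⊕ Y555.Line) (ζ : ℂˣ), orderOf ζ = 3 →
        Y555.reflection ζ (Y555.root v) ∈ Y555.R f) ∧
      Y555.L33 ≤ Y555.R f :=
  ⟨Y555.nonempty_diagram_embedding, fun f =>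
    ⟨Y555.span_root_eq f, fun v _ hζ => Y555.reflection_mem f v hζ, Y555.L33_le f⟩⟩
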